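/- **Setting.** Let $\mathbf X\in\mathbb R^p$, $\mathbf Y\in\mathbb R^r$ be random vectors following the linear model $\mathbf Y=\boldsymbol\alpha+\boldsymbol\beta\mathbf X+\boldsymbol\varepsilon$ with $\boldsymbol\varepsilon$ independent of $\mathbf X$, and suppose that for some $\sigma>0$, $P(|\mathbf w^{\top}(\mathbf X^\top,\mathbf Y^\top)^\top|\ge t)\le 2\exp(-t^2/\sigma^2)$ for all unit vectors $\mathbf w\in\mathbb R^{p+r}$ and all $t\ge0$. Write $\boldsymbol\Sigma_{\mathbf X},\boldsymbol\Sigma_{\mathbf Y},\boldsymbol\Sigma_{\mathbf{XY}},\boldsymbol\Sigma_{\mathbf{YX}}$ for the (cross-)covariance matrices, and $\widehat{\boldsymbol\Sigma}$ with the same subscripts for the (centered) sample covariance matrices of $n$ i.i.d. copies of $(\mathbf X,\mathbf Y)$. Consider either the response case, $\mathbf M=\boldsymbol\Sigma_{\mathbf Y}$, $\mathbf A=\boldsymbol\Sigma_{\mathbf{YX}}$, $\widehat{\mathbf M}=\widehat{\boldsymbol\Sigma}_{\mathbf Y}$, $\widehat{\mathbf A}=\widehat{\boldsymbol\Sigma}_{\mathbf{YX}}$,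 $q=r$, or the predictor case, $\mathbf M=\boldsymbol\Sigma_{\mathbf X}$, $\mathbf A=\boldsymbol\Sigma_{\mathbf{XY}}$, $\widehat{\mathbf M}=\widehat{\boldsymbol\Sigma}_{\mathbf X}$, $\widehat{\mathbf A}=\widehat{\boldsymbol\Sigma}_{\mathbf{XY}}$, $q=p$; put $\mathbf U=\mathbf A\mathbf A^\top$, $\widehat{\mathbf U}=\widehat{\mathbf A}\widehat{\mathbf A}^\top$. A subspace $\mathcal R\subseteq\mathbb R^q$ with orthogonal projection $\mathbf P_{\mathcal R}$ and $\mathbf Q_{\mathcal R}=\mathbf I-\mathbf P_{\mathcal R}$ reduces $\mathbf M$ if $\mathbf M=\mathbf P_{\mathcal R}\mathbf M\mathbf P_{\mathcal R}+\mathbf Q_{\mathcal R}\mathbf M\mathbf Q_{\mathcal R}$. Let $\mathcal E$ be the envelope, i.e. the intersection of all reducing subspaces of $\mathbf M$ that contain the column space of $\mathbf A$, and let $u=\dim\mathcal E\ge1$. Let $\lambda_1\ge\dots\ge\lambda_q$ be the eigenvalues of $\mathbf M$ with orthonormal eigenvectors $\mathbf v_1,\dots,\mathbf v_q$ (and $\lambda_{q+1}=-\infty$),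 and let $d\le q$ be such that $\mathcal E\subseteq\mathrm{span}(\mathbf v_1,\dots,\mathbf v_d)$ and $\Delta=\min_{1\le j\le d}(\lambda_j-\lambda_{j+1})>0$. Let $\phi_{(1)}\ge\dots\ge\phi_{(d)}$ be the ordered envelope scores $\mathbf v_j^\top\mathbf U\mathbf v_j$, $1\le j\le d$, let $\Delta_{\mathbf U}=\phi_{(u)}-\phi_{(u+1)}$ (with $\phi_{(d+1)}=0$), and let $\nu=\|\mathbf U\|_{op}$. The estimator $\widehat{\mathcal E}$ (NIECE) is the span of those $u$ among the first $d$ orthonormal eigenvectors $\widehat{\mathbf v}_j$ of $\widehat{\mathbf M}$ (eigenvalues in decreasing order) that have the largest scores $\widehat{\mathbf v}_j^\top\widehat{\mathbf U}\widehat{\mathbf v}_j$, ties being broken arbitrarily. For a matrix, $\|\boldsymbol\Omega\|_1=\max_j\sum_i|\omega_{ij}|$. **Theorem.** For all $\sigma,c_1>0$ there are constants $C,c>0$, depending only on $\sigma$ and $c_1$, such that in the above setting the following holds. If $\epsilon>0$ satisfies $$\epsilon\le\min\Big\{\frac{\Delta}{4},\ \frac{\Delta_{\mathbf U}}{2}\Big(1+\frac{10\nu}{\Delta}\Big)^{-1}\Big\}\quad\text{and}\quad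 \epsilon\le\|\boldsymbol\Sigma_{\mathbf{XY}}\|_1+\|\boldsymbol\Sigma_{\mathbf{YX}}\|_1<c_1,$$ then, in both the response and the predictor case, $$\|\mathbf P_{\widehat{\mathcal E}}-\mathbf P_{\mathcal E}\|_F\le\frac{2\sqrt{2u}\,\epsilon}{\Delta}$$ with probability at least $$1-Cr^2e^{-cn\epsilon^2/r^2}-Cpr\,e^{-cn\epsilon^2/r^2}-Cpr\,e^{-cn\epsilon^2/p^2}.$$ In the predictor case the same is also true with $p$ and $r$ interchanged in this probability bound. -/

import Mathlib

open MeasureTheory ProbabilityTheory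

noncomputable section

namespace Niece

/-! ### Matrix norms and projection matrices -/

/-- Frobenius norm: square root of the sum of the squared entries. -/
def frobeniusNorm {q m : ℕ} (A : Matrix (Fin q) (Fin m) ℝ) : ℝ :=
  Real.sqrt (∑ i, ∑ j, A i j ^ 2)

/-- The norm `‖A‖₁ = max_j ∑_i |a_ij|` (maximal absolute column sum). -/
def colSumNorm {q m : ℕ} (A : Matrix (Fin q) (Fin m) ℝ) : ℝ :=
  ⨆ j, ∑ i, |A i j|

/-- Operator norm of a square matrix acting on Euclidean space. -/
def opNorm {q : ℕ} (A : Matrix (Fin q) (Fin q) ℝ) : ℝ :=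
  ‖Matrix.toEuclideanCLM (n := Fin q) (𝕜 := ℝ) A‖

/-- The matrix `P_R` of the orthogonal projection onto the subspace `R`. -/
def projMatrix {q : ℕ} (R : Submodule ℝ (EuclideanSpace ℝ (Fin q))) :
    Matrix (Fin q) (Fin q) ℝ :=
  Matrix.of fun i j => (R.starProjection (EuclideanSpace.single j (1 : ℝ))) i

/-! ### Envelopes -/

/-- `R` is a reducing subspace of `M`: `M = P_R M P_R + Q_R M Q_R` with `Q_R = I - P_R`. -/
def IsReducing {q : ℕ} (M : Matrix (Fin q) (Fin q) ℝ)
    (R : Submodule ℝ (EuclideanSpace ℝ (Fin q))) : Prop :=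
  M = projMatrix R * M * projMatrix R + (1 - projMatrix R) * M * (1 - projMatrix R)

/-- The span of the columns of a matrix. -/
def colSpan {q m : ℕ} (A : Matrix (Fin q) (Fin m) ℝ) :
    Submodule ℝ (EuclideanSpace ℝ (Fin q)) :=
  Submodule.span ℝ (Set.range fun j => WithLp.toLp 2 (fun i => A i j))

/-- The `M`-envelope of `span(A)`: the intersection of all reducing subspaces of `M` that
contain `span(A)`. -/
def envelope {q m : ℕ} (M : Matrix (Fin q) (Fin q) ℝ) (A : Matrix (Fin q) (Fin m) ℝ) :
    Submodule ℝ (EuclideanSpace ℝ (Fin q)) :=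
  sInf {R | IsReducing M R ∧ colSpan A ≤ R}

/-! ### The NIECE procedure -/

/-- `v` is an orthonormal basis of eigenvectors of `M`, listed with the eigenvalues `lam` in
decreasing order (multiplicities included). -/
def IsOrderedEigenbasis {q : ℕ} (M : Matrix (Fin q) (Fin q) ℝ) (lam : Fin q → ℝ)
    (v : OrthonormalBasis (Fin q) ℝ (EuclideanSpace ℝ (Fin q))) : Prop :=
  Antitone lam ∧ ∀ j, Matrix.toEuclideanCLM (n := Fin q) (𝕜 := ℝ) M (v j) = lam j • v j

/-- The envelope score `xᵀ U x` of a vector `x`. -/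
def score {q : ℕ} (U : Matrix (Fin q) (Fin q) ℝ) (x : EuclideanSpace ℝ (Fin q)) : ℝ :=
  ∑ i, ∑ j, x i * U i j * x j

/-- `π` arranges the scores of the first `d` vectors of `v` in decreasing order. -/
def SortsScores {q d : ℕ} (hd : d ≤ q) (U : Matrix (Fin q) (Fin q) ℝ)
    (v : OrthonormalBasis (Fin q) ℝ (EuclideanSpace ℝ (Fin q)))
    (π : Equiv.Perm (Fin d)) : Prop :=
  Antitone fun j : Fin d => score U (v (Fin.castLE hd (π j)))

/-- `E` is an output of the NIECE procedure with input `M`, `U`, `d`, `u`: take the first `d`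
eigenvectors of `M`, sort them by decreasing envelope score and let `E` be the span of the
first `u` of the sorted vectors. In the presence of ties (or of multiple eigenvalues) every
admissible choice counts as an output. -/
def IsNieceOutput {q : ℕ} (M U : Matrix (Fin q) (Fin q) ℝ) (d u : ℕ)
    (E : Submodule ℝ (EuclideanSpace ℝ (Fin q))) : Prop :=
  ∃ (hd : d ≤ q) (lam : Fin q → ℝ)
    (v : OrthonormalBasis (Fin q) ℝ (EuclideanSpace ℝ (Fin q))) (π : Equiv.Perm (Fin d)),
    IsOrderedEigenbasis M lam v ∧ SortsScores hd U v π ∧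
      E = Submodule.span ℝ {x | ∃ j : Fin d, (j : ℕ) < u ∧ x = v (Fin.castLE hd (π j))}

/-! ### Population quantities -/

/-- The gaps `λ_j - λ_{j+1}`, `1 ≤ j ≤ d`, between consecutive eigenvalues (indices shifted
by one below). If `d = q` then `λ_{q+1} = -∞`, so that the last gap is infinite and does not
contribute. -/
def eigenGaps {q : ℕ} (lam : Fin q → ℝ) (d : ℕ) : Set ℝ :=
  {g | ∃ (j : ℕ) (h : j + 1 < q), j < d ∧
    g = lam ⟨j, Nat.lt_of_succ_lt h⟩ - lam ⟨j + 1, h⟩}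

/-- `Δ` is the minimal eigen-gap. It is the minimum of `eigenGaps lam d`; in the degenerate case
`d = q = 1`, where there is no finite gap and the minimum is `+∞`, every real number is
allowed. -/
def IsMinEigenGap {q : ℕ} (lam : Fin q → ℝ) (d : ℕ) (Δ : ℝ) : Prop :=
  (eigenGaps lam d).Nonempty → IsLeast (eigenGaps lam d) Δ

/-- The difference of the `u`-th and the `(u+1)`-st largest of the `d` envelope scores, where
the scores after the `d`-th are zero. -/
def scoreGap {q d : ℕ} (hd : d ≤ q) (U : Matrix (Fin q) (Fin q) ℝ)
    (v : OrthonormalBasis (Fin q) ℝ (EuclideanSpace ℝ (Fin q)))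
    (π : Equiv.Perm (Fin d)) (u : ℕ) : ℝ :=
  (if h : u - 1 < d then score U (v (Fin.castLE hd (π ⟨u - 1, h⟩))) else 0)
    - (if h : u < d then score U (v (Fin.castLE hd (π ⟨u, h⟩))) else 0)

/-- The standing assumptions on a population pair `(M, A)`, `U = A Aᵀ`, together with the
quantities attached to it: the envelope `ℰ_M(A)` has dimension `u ≥ 1` and lies in the span of the
first `d` eigenvectors of `M`; `Δ > 0` is the minimal eigen-gap of the first `d` eigenvalues
(in particular these are distinct); `ΔU` is the envelope score gap. -/
def PopulationSetting {q m : ℕ} (M : Matrix (Fin q) (Fin q) ℝ) (A : Matrix (Fin q) (Fin m) ℝ)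
    (d u : ℕ) (Δ ΔU : ℝ) : Prop :=
  1 ≤ u ∧ Module.finrank ℝ (envelope M A) = u ∧ 0 < Δ ∧
  ∃ (hd : d ≤ q) (lam : Fin q → ℝ)
    (v : OrthonormalBasis (Fin q) ℝ (EuclideanSpace ℝ (Fin q))) (π : Equiv.Perm (Fin d)),
    IsOrderedEigenbasis M lam v ∧
    envelope M A ≤ Submodule.span ℝ (Set.range fun j : Fin d => v (Fin.castLE hd j)) ∧
    IsMinEigenGap lam d Δ ∧
    SortsScores hd (A * A.transpose) v π ∧
    ΔU = scoreGap hd (A * A.transpose) v π u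

/-! ### Population and sample covariances, the regression model -/

/-- The (cross-)covariance matrix of two random vectors. -/
def covMatrix {Ω : Type*} [MeasurableSpace Ω] (P : Measure Ω) {a b : ℕ}
    (V : Ω → Fin a → ℝ) (W : Ω → Fin b → ℝ) : Matrix (Fin a) (Fin b) ℝ :=
  Matrix.of fun i j => covariance (fun ω => V ω i) (fun ω => W ω j) P

/-- The sample mean `n⁻¹ ∑_k V_k`. -/
def sampleMean {n a : ℕ} (V : Fin n → Fin a → ℝ) (i : Fin a) : ℝ :=
  (n : ℝ)⁻¹ * ∑ k, V k i

/-- The sample (cross-)covariance matrix `n⁻¹ ∑_k (V_k - V̄) (W_k - W̄)ᵀ`. -/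
def sampleCov {n a b : ℕ} (V : Fin n → Fin a → ℝ) (W : Fin n → Fin b → ℝ) :
    Matrix (Fin a) (Fin b) ℝ :=
  Matrix.of fun i j =>
    (n : ℝ)⁻¹ * ∑ k, (V k i - sampleMean V i) * (W k j - sampleMean W j)

/-- The linear model `Y = α + β X + e` with `e` independent of `X`. -/
def IsLinearModel {Ω : Type*} [MeasurableSpace Ω] (P : Measure Ω) {p r : ℕ}
    (X : Ω → Fin p → ℝ) (Y : Ω → Fin r → ℝ) : Prop :=
  ∃ (α : Fin r → ℝ) (β : Matrix (Fin r) (Fin p) ℝ) (e : Ω → Fin r → ℝ),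
    Measurable e ∧ IndepFun X e P ∧ ∀ ω, Y ω = α + β.mulVec (X ω) + e ω

/-- Joint sub-Gaussian tails of `(X, Y)` with parameter `σ`: for each unit vector
`w = (w₁, w₂)`, `P(|wᵀ(X, Y)| ≥ t) ≤ 2 exp(-t²/σ²)`. -/
def IsJointlySubGaussian {Ω : Type*} [MeasurableSpace Ω] (P : Measure Ω) {p r : ℕ}
    (X : Ω → Fin p → ℝ) (Y : Ω → Fin r → ℝ) (σ : ℝ) : Prop :=
  ∀ (w₁ : Fin p → ℝ) (w₂ : Fin r → ℝ), (∑ i, w₁ i ^ 2) + (∑ j, w₂ j ^ 2) = 1 →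
    ∀ t : ℝ, 0 ≤ t →
      P.real {ω | t ≤ |(∑ i, w₁ i * X ω i) + ∑ j, w₂ j * Y ω j|} ≤
        2 * Real.exp (-(t ^ 2 / σ ^ 2))

/-- `(Xs k, Ys k)`, `k < n`, are independent copies of `(X, Y)`. -/
def IsIIDSample {Ω : Type*} [MeasurableSpace Ω] (P : Measure Ω) {n p r : ℕ}
    (X : Ω → Fin p → ℝ) (Y : Ω → Fin r → ℝ)
    (Xs : Fin n → Ω → Fin p → ℝ) (Ys : Fin n → Ω → Fin r → ℝ) : Prop :=
  iIndepFun (fun k ω => (Xs k ω, Ys k ω)) P ∧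
    ∀ k, IdentDistrib (fun ω => (Xs k ω, Ys k ω)) (fun ω => (X ω, Y ω)) P P

/-! ### The bounds -/

/-- The admissible range of `ε`:
`0 < ε ≤ min {Δ/4, (ΔU/2) (1 + 10 ν/Δ)⁻¹}`. -/
def SmallEps (ε Δ ΔU ν : ℝ) : Prop :=
  0 < ε ∧ ε ≤ min (Δ / 4) (ΔU / 2 * (1 + 10 * ν / Δ)⁻¹)

/-- `1 - C r² exp(-c n ε²/r²) - C p r exp(-c n ε²/r²) - C p r exp(-c n ε²/p²)`. -/
def probBound (C c : ℝ) (n p r : ℕ) (ε : ℝ) : ℝ :=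
  1 - C * (r : ℝ) ^ 2 * Real.exp (-(c * (n * ε ^ 2 / (r : ℝ) ^ 2)))
    - C * ((p : ℝ) * r) * Real.exp (-(c * (n * ε ^ 2 / (r : ℝ) ^ 2)))
    - C * ((p : ℝ) * r) * Real.exp (-(c * (n * ε ^ 2 / (p : ℝ) ^ 2)))

/-- On a measurable event of probability at least `b`, every output `E` of NIECE run on the random
matrices `Mhat`, `Uhat` satisfies `‖P_E - P_ℰ‖_F ≤ δ`. -/
def NieceErrorAtMost {Ω : Type*} [MeasurableSpace Ω] (P : Measure Ω) {q : ℕ}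
    (Mhat Uhat : Ω → Matrix (Fin q) (Fin q) ℝ) (d u : ℕ)
    (ℰ : Submodule ℝ (EuclideanSpace ℝ (Fin q))) (δ b : ℝ) : Prop :=
  ∃ S : Set Ω, MeasurableSet S ∧ b ≤ P.real S ∧
    ∀ ω ∈ S, ∀ E, IsNieceOutput (Mhat ω) (Uhat ω) d u E →
      frobeniusNorm (projMatrix E - projMatrix ℰ) ≤ δ

end Niece

end

/-! The theorem splits into a deterministic perturbation bound and a concentration inequality.

Deterministic half (`frobeniusNorm_nieceOutput_sub_le`). The first d eigenvalues of M are simple, so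
each of the eigenvectors v_1, …, v_d lies in the envelope or in its orthogonal complement, and the
envelope is spanned by u of them. The columns of A lie in the envelope, so the remaining scores
vanish, while the u relevant ones are at least Δ_U. If the absolute row sums of M̂ − M are at most
ε, Schur's test bounds the operator norm, Weyl's inequality matches the eigenvalues, and a
Davis–Kahan argument bounds the sine of the angle between v_j and v̂_j by 2ε/Δ. If moreover the row
sums of Û − U are at most ε/2, every score moves by less than Δ_U/2. Hence NIECE selects exactly the
right indices, and the squared Frobenius distance is at most twice the sum of u squared sines.

Probabilistic half (`exists_measureReal_rowSum_le`). Sub-Gaussian tails give exponential moments of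
squares, hence of centered products. After centering at the population means, the error of a sample
covariance is an i.i.d. average of centered products minus a product of two sample-mean errors. By
Jensen the resulting moment bound passes to the average over a whole row, so Chernoff's bound
controls a row sum at once and the union bound counts rows only. Since ε < c₁, the Chernoff
parameter stays where the log-moment is quadratic, and the exponent is nε² over the squared number
of columns. Using this for M̂, Â and Âᵀ gives three terms, which are then enlarged to the stated
ones. -/

namespace Niece

open scoped RealInnerProductSpace

/-! ### Eigenbases: Weyl, Davis–Kahan, invariant subspaces -/

section Spectral

variable {E : Type*} [NormedAddCommGroup E] [InnerProductSpace ℝ E] {q : ℕ}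

/-- Coefficients of `T x` in an eigenbasis of `T`. -/
lemma inner_apply_of_eigenbasis {T : E →L[ℝ] E} {lam : Fin q → ℝ}
    (v : OrthonormalBasis (Fin q) ℝ E) (hT : ∀ j, T (v j) = lam j • v j) (i : Fin q) (x : E) :
    ⟪v i, T x⟫ = lam i * ⟪v i, x⟫ := by
  conv_lhs => rw [← v.sum_repr' x]
  simp only [map_sum, map_smul, hT, inner_sum, inner_smul_right]
  rw [Finset.sum_eq_single i]
  · simp; ring
  · intro k _ hk
    simp [v.inner_eq_ite, hk.symm]
  · simp

lemma inner_apply_self_of_eigenbasis {T : E →L[ℝ] E} {lam : Fin q → ℝ}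
    (v : OrthonormalBasis (Fin q) ℝ E) (hT : ∀ j, T (v j) = lam j • v j) (x : E) :
    ⟪x, T x⟫ = ∑ i, lam i * ⟪v i, x⟫ ^ 2 := by
  rw [← v.sum_inner_mul_inner]
  refine Finset.sum_congr rfl fun i _ => ?_
  rw [inner_apply_of_eigenbasis v hT, real_inner_comm]
  ring

lemma sum_sq_inner_eq {q : ℕ} (v : OrthonormalBasis (Fin q) ℝ E) (x : E) :
    ∑ i, ⟪v i, x⟫ ^ 2 = ‖x‖ ^ 2 := by
  rw [← v.sum_sq_norm_inner_right x]
  simp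

/-- Weyl's inequality, one-sided, for ordered eigenvalues. -/
lemma eigenvalue_le_add {T S : E →L[ℝ] E} {lam mu : Fin q → ℝ}
    (v w : OrthonormalBasis (Fin q) ℝ E) (hT : ∀ j, T (v j) = lam j • v j)
    (hS : ∀ j, S (w j) = mu j • w j) (hlam : Antitone lam) (hmu : Antitone mu)
    {ε : ℝ} (h : ∀ x, ‖S x - T x‖ ≤ ε * ‖x‖) (j : Fin q) : lam j ≤ mu j + ε := by
  have : FiniteDimensional ℝ E := v.toBasis.finiteDimensional_of_finite
  -- Courant–Fischer by a dimension count: q − 1 linear conditions, orthogonality to `v i` for i > j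
  -- and to `w i` for i < j, have a common nonzero solution x. On it the form of T is at least `lam
  -- j` and that of S at most `mu j`.
  let f : E →ₗ[ℝ] ({i : Fin q // i ≠ j} → ℝ) :=
    LinearMap.pi fun i => if j < i.1 then (innerSL ℝ (v i.1)).toLinearMap
      else (innerSL ℝ (w i.1)).toLinearMap
  have hker : LinearMap.ker f ≠ ⊥ := by
    apply LinearMap.ker_ne_bot_of_finrank_lt
    rw [Module.finrank_eq_card_basis v.toBasis, Module.finrank_pi]
    exact Fintype.card_subtype_lt (x := j) (by simp)
  obtain ⟨x, hx, hx0⟩ := Submodule.exists_mem_ne_zero_of_ne_bot hker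
  have hfx : ∀ i (hi : i ≠ j), f x ⟨i, hi⟩ = 0 := fun i hi => by
    rw [LinearMap.mem_ker.1 hx]; rfl
  have hv : ∀ i, j < i → ⟪v i, x⟫ = 0 := fun i hi => by
    simpa [f, hi] using hfx i hi.ne'
  have hw : ∀ i, i < j → ⟪w i, x⟫ = 0 := fun i hi => by
    simpa [f, hi.not_gt] using hfx i hi.ne
  have h1 : lam j * ‖x‖ ^ 2 ≤ ⟪x, T x⟫ := by
    rw [inner_apply_self_of_eigenbasis v hT, ← sum_sq_inner_eq v, Finset.mul_sum]
    refine Finset.sum_le_sum fun i _ => ?_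
    rcases lt_or_ge j i with hi | hi
    · simp [hv i hi]
    · exact mul_le_mul_of_nonneg_right (hlam hi) (sq_nonneg _)
  have h2 : ⟪x, S x⟫ ≤ mu j * ‖x‖ ^ 2 := by
    rw [inner_apply_self_of_eigenbasis w hS, ← sum_sq_inner_eq w, Finset.mul_sum]
    refine Finset.sum_le_sum fun i _ => ?_
    rcases lt_or_ge i j with hi | hi
    · simp [hw i hi]
    · exact mul_le_mul_of_nonneg_right (hmu hi) (sq_nonneg _)
  have h3 : |⟪x, S x - T x⟫| ≤ ‖x‖ * (ε * ‖x‖) :=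
    (abs_real_inner_le_norm _ _).trans (mul_le_mul_of_nonneg_left (h x) (norm_nonneg _))
  rw [inner_sub_right] at h3
  have h4 := (abs_le.1 h3).1
  have hpos : 0 < ‖x‖ ^ 2 := by positivity
  refine le_of_mul_le_mul_right ?_ hpos
  nlinarith

/-- A Davis–Kahan type bound for one eigenvector. -/
lemma one_sub_inner_sq_le {T S : E →L[ℝ] E} {lam mu : Fin q → ℝ}
    (v w : OrthonormalBasis (Fin q) ℝ E) (hT : ∀ j, T (v j) = lam j • v j)
    (hS : ∀ j, S (w j) = mu j • w j) {ε Δ : ℝ} (hΔ : 0 < Δ) (hεΔ : ε ≤ Δ / 4)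
    (h : ∀ x, ‖S x - T x‖ ≤ ε * ‖x‖) (j : Fin q) (hj : |lam j - mu j| ≤ ε)
    (hgap : ∀ k, k ≠ j → Δ ≤ |lam k - lam j|) :
    1 - ⟪v j, w j⟫ ^ 2 ≤ (2 * ε / Δ) ^ 2 := by
  have hnorm : ‖S (w j) - T (w j)‖ ≤ ε := by simpa using h (w j)
  -- The residual S w_j − T w_j has v_k-coefficient (mu_j − lam_k)⟨v_k, w_j⟩; its small norm forces
  -- the off-diagonal coefficients to be small.
  have h1 : ∑ k, (mu j - lam k) ^ 2 * ⟪v k, w j⟫ ^ 2 = ‖S (w j) - T (w j)‖ ^ 2 := by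
    rw [← sum_sq_inner_eq v]
    refine Finset.sum_congr rfl fun k _ => ?_
    rw [inner_sub_right, inner_apply_of_eigenbasis v hT, hS, inner_smul_right]
    ring
  -- For k ≠ j the weight |mu_j − lam_k| is at least Δ − ε ≥ 3Δ/4; the cruder Δ/2 suffices and gives
  -- the factor 2 in 2ε/Δ.
  have h2 : ∑ k, (Δ / 2) ^ 2 * ⟪v k, w j⟫ ^ 2 - (Δ / 2) ^ 2 * ⟪v j, w j⟫ ^ 2 ≤
      ∑ k, (mu j - lam k) ^ 2 * ⟪v k, w j⟫ ^ 2 := by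
    rw [← Finset.sum_erase_add _ _ (Finset.mem_univ j), add_sub_cancel_right]
    refine (Finset.sum_le_sum fun k hk => ?_).trans
      (Finset.sum_le_univ_sum_of_nonneg fun k => by positivity)
    refine mul_le_mul_of_nonneg_right ?_ (sq_nonneg _)
    rw [sq_le_sq, abs_of_pos (by positivity)]
    have h3 := hgap k (Finset.ne_of_mem_erase hk)
    have h4 : |lam k - lam j| ≤ |mu j - lam k| + |lam j - mu j| := by
      rw [abs_sub_comm (mu j)]
      have := abs_sub_le (lam k) (mu j) (lam j)
      rwa [abs_sub_comm (mu j) (lam j)] at this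
    linarith
  rw [h1, ← Finset.mul_sum, sum_sq_inner_eq] at h2
  have h5 : ‖S (w j) - T (w j)‖ ^ 2 ≤ ε ^ 2 := by gcongr
  simp only [OrthonormalBasis.norm_eq_one] at h2
  rw [div_pow, le_div_iff₀ (by positivity)]
  nlinarith

/-- Change of a quadratic form between two unit vectors. -/
lemma abs_quadratic_sub_le {U : E →L[ℝ] E} (hU : ∀ x y, ⟪U x, y⟫ = ⟪x, U y⟫) {v w : E}
    (hv : ‖v‖ = 1) (hw : ‖w‖ = 1) {s : ℝ} (hs0 : 0 ≤ s) (hs1 : s ≤ 1)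
    (h : 1 - ⟪v, w⟫ ^ 2 ≤ s ^ 2) :
    |⟪w, U w⟫ - ⟪v, U v⟫| ≤ 4 * ‖U‖ * s := by
  set c := ⟪v, w⟫ with hc
  set z := w - c • v with hz
  have hww : w = c • v + z := by simp [hz]
  have hzn : ‖z‖ ^ 2 = 1 - c ^ 2 := by
    rw [hz, norm_sub_sq_real, norm_smul, hw, hv, inner_smul_right, real_inner_comm, ← hc,
      Real.norm_eq_abs, mul_one, sq_abs]
    ring
  have hzs : ‖z‖ ≤ s := by
    refine abs_le_of_sq_le_sq' (by rw [hzn]; exact h) hs0 |>.2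
  have hc1 : |c| ≤ 1 := by simpa [hv, hw] using abs_real_inner_le_norm v w
  -- With w = c v + z and z ⊥ v, ‖z‖² = 1 − c² ≤ s². The three terms contribute s, 2s and s times
  -- ‖U‖, where s² ≤ s is used for the outer two.
  have key : ⟪w, U w⟫ - ⟪v, U v⟫ = -(‖z‖ ^ 2) * ⟪v, U v⟫ + 2 * c * ⟪v, U z⟫ + ⟪z, U z⟫ := by
    have h1 : ⟪z, U v⟫ = ⟪v, U z⟫ := by rw [← hU, real_inner_comm]
    rw [hzn]
    conv_lhs => rw [hww]
    simp only [map_add, map_smul, inner_add_left, inner_add_right, inner_smul_left,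
      inner_smul_right, h1, RCLike.conj_to_real]
    ring
  have hb : ∀ x y : E, |⟪x, U y⟫| ≤ ‖x‖ * ‖U‖ * ‖y‖ := fun x y => by
    rw [mul_assoc]
    exact (abs_real_inner_le_norm _ _).trans
      (mul_le_mul_of_nonneg_left (U.le_opNorm y) (norm_nonneg _))
  have hν := norm_nonneg U
  have b1 := hb v v
  have b2 := hb v z
  have b3 := hb z z
  rw [hv] at b1 b2
  have hz0 := norm_nonneg z
  rw [key]
  have e1 : |-(‖z‖ ^ 2) * ⟪v, U v⟫| ≤ s * ‖U‖ := by
    rw [abs_mul, abs_neg, abs_of_nonneg (sq_nonneg _)]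
    calc ‖z‖ ^ 2 * |⟪v, U v⟫| ≤ s * (1 * ‖U‖ * 1) := by
          refine mul_le_mul ?_ b1 (abs_nonneg _) hs0
          nlinarith
      _ = _ := by ring
  have e2 : |2 * c * ⟪v, U z⟫| ≤ 2 * (s * ‖U‖) := by
    rw [abs_mul, abs_mul, abs_two]
    have : |c| * |⟪v, U z⟫| ≤ 1 * (s * ‖U‖) :=
      mul_le_mul hc1 (b2.trans (by nlinarith)) (abs_nonneg _) zero_le_one
    linarith
  have e3 : |⟪z, U z⟫| ≤ s * ‖U‖ := by
    refine b3.trans ?_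
    have : ‖z‖ * ‖z‖ ≤ s := by nlinarith
    nlinarith
  have := abs_add_three (-(‖z‖ ^ 2) * ⟪v, U v⟫) (2 * c * ⟪v, U z⟫) ⟪z, U z⟫
  linarith

/-- A simple eigenvector lies in an invariant subspace or in its orthogonal complement. -/
lemma mem_or_mem_orthogonal {T : E →L[ℝ] E} {lam : Fin q → ℝ}
    (hsymm : ∀ x y, ⟪T x, y⟫ = ⟪x, T y⟫)
    (v : OrthonormalBasis (Fin q) ℝ E) (hT : ∀ j, T (v j) = lam j • v j)
    (R : Submodule ℝ E) [R.HasOrthogonalProjection] (hR : ∀ x ∈ R, T x ∈ R) (j : Fin q)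
    (hj : ∀ k, k ≠ j → lam k ≠ lam j) : v j ∈ R ∨ v j ∈ Rᗮ := by
  obtain ⟨y, hy, z, hz, hyz⟩ := R.exists_add_mem_mem_orthogonal (v j)
  have hTz : T z ∈ Rᗮ := by
    rw [Submodule.mem_orthogonal] at hz ⊢
    intro x hx
    rw [← hsymm]
    exact hz _ (hR x hx)
  -- The left side lies in R and the right side in Rᗮ, so both vanish. Thus y is zero or an
  -- eigenvector for the simple eigenvalue `lam j`, that is, a multiple of `v j`.
  have h1 : T y - lam j • y = lam j • z - T z := by
    have := hT j
    rw [hyz, map_add, smul_add] at this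
    rw [sub_eq_sub_iff_add_eq_add, this, add_comm]
  have h2 : T y - lam j • y = 0 := by
    refine Submodule.disjoint_def.1 R.orthogonal_disjoint _
      (R.sub_mem (hR y hy) (R.smul_mem _ hy)) ?_
    rw [h1]
    exact Rᗮ.sub_mem (Rᗮ.smul_mem _ hz) hTz
  have h3 : ∀ k, k ≠ j → ⟪v k, y⟫ = 0 := fun k hk => by
    have h4 := inner_apply_of_eigenbasis v hT k y
    rw [sub_eq_zero.1 h2, inner_smul_right] at h4
    by_contra h0
    exact hj k hk (mul_right_cancel₀ h0 h4.symm)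
  have h5 : y = ⟪v j, y⟫ • v j := by
    conv_lhs => rw [← v.sum_repr' y]
    exact Finset.sum_eq_single j (fun k _ hk => by rw [h3 k hk, zero_smul]) (by simp)
  rcases eq_or_ne ⟪v j, y⟫ 0 with h0 | h0
  · right
    rw [h0, zero_smul] at h5
    rwa [hyz, h5, zero_add]
  · left
    have : v j = ⟪v j, y⟫⁻¹ • y := by
      rw [eq_inv_smul_iff₀ h0]
      exact h5.symm
    rw [this]
    exact R.smul_mem _ hy

/-- An invariant subspace contained in the span of simple eigenvectors is spanned by those of
them that it contains. -/
lemma eq_span_of_invariant {T : E →L[ℝ] E} {lam : Fin q → ℝ}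
    (hsymm : ∀ x y, ⟪T x, y⟫ = ⟪x, T y⟫)
    (v : OrthonormalBasis (Fin q) ℝ E) (hT : ∀ j, T (v j) = lam j • v j)
    (R : Submodule ℝ E) [R.HasOrthogonalProjection] (hR : ∀ x ∈ R, T x ∈ R) (s : Set (Fin q))
    (hs : ∀ j ∈ s, ∀ k, k ≠ j → lam k ≠ lam j) (hRs : R ≤ Submodule.span ℝ (v '' s)) :
    R = Submodule.span ℝ (v '' {j | j ∈ s ∧ v j ∈ R}) := by
  apply le_antisymm
  · intro x hx
    rw [← v.sum_repr' x]
    refine Submodule.sum_mem _ fun k _ => ?_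
    by_cases hk : k ∈ s ∧ v k ∈ R
    · exact Submodule.smul_mem _ _ (Submodule.subset_span ⟨k, hk, rfl⟩)
    · suffices ⟪v k, x⟫ = 0 by simp [this]
      by_cases hks : k ∈ s
      · have := (mem_or_mem_orthogonal hsymm v hT R hR k (hs k hks)).resolve_left
          fun h => hk ⟨hks, h⟩
        exact (Submodule.mem_orthogonal' _ _).1 this x hx
      · have : Submodule.span ℝ (v '' s) ≤ (Submodule.span ℝ {v k})ᗮ := by
          rw [Submodule.span_le]
          rintro _ ⟨i, hi, rfl⟩
          refine (Submodule.mem_orthogonal_singleton_iff_inner_right).2 ?_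
          rw [v.inner_eq_ite, if_neg]
          rintro rfl
          exact hks hi
        exact Submodule.mem_orthogonal_singleton_iff_inner_right.1 (this (hRs hx))
  · rw [Submodule.span_le]
    rintro _ ⟨j, hj, rfl⟩
    exact hj.2

/-- The orthogonal projection onto the span of part of an orthonormal basis. -/
lemma starProjection_span_image (v : OrthonormalBasis (Fin q) ℝ E) (J : Finset (Fin q))
    (R : Submodule ℝ E) [R.HasOrthogonalProjection]
    (hR : R = Submodule.span ℝ (v '' (J : Set (Fin q)))) (x : E) :
    R.starProjection x = ∑ j ∈ J, ⟪v j, x⟫ • v j := by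
  apply Submodule.eq_starProjection_of_mem_orthogonal
  · rw [hR]
    exact Submodule.sum_mem _ fun j hj =>
      Submodule.smul_mem _ _ (Submodule.subset_span ⟨j, hj, rfl⟩)
  · rw [hR, Submodule.mem_orthogonal]
    intro y hy
    induction hy using Submodule.span_induction with
    | mem y hy =>
      obtain ⟨k, hk, rfl⟩ := hy
      rw [Finset.mem_coe] at hk
      rw [inner_sub_right, inner_sum]
      simp [inner_smul_right, v.inner_eq_ite, hk]
    | zero => simp
    | add a b _ _ ha hb => rw [inner_add_left, ha, hb, add_zero]
    | smul a b _ hb => rw [inner_smul_left, hb, mul_zero]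

end Spectral

/-! ### Selecting the largest scores; distance of projections -/

/-- Positions below `u` in a sorting permutation are occupied exactly by a set of `u` indices whose
values exceed all others. -/
lemma image_sort_eq {d u : ℕ} {f : Fin d → ℝ} {π : Equiv.Perm (Fin d)}
    (hπ : Antitone fun j => f (π j)) (J : Finset (Fin d)) (hJ : J.card = u)
    (hf : ∀ j ∈ J, ∀ k, k ∉ J → f k < f j) (j : Fin d) : (j : ℕ) < u ↔ π j ∈ J := by
  have hcard : (Finset.univ.filter fun j : Fin d => (j : ℕ) < u).card = u := by
    have hud : u ≤ d := by simpa [hJ] using Finset.card_le_univ J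
    rw [Fin.card_filter_val_lt]
    simpa using hud
  have hcard' : (Finset.univ.filter fun j : Fin d => π j ∈ J).card = u := by
    rw [← hJ, ← Finset.card_map π.symm.toEmbedding (s := J)]
    congr 1
    ext i
    simp
  have hsub : (Finset.univ.filter fun j : Fin d => π j ∈ J) =
      Finset.univ.filter fun j : Fin d => (j : ℕ) < u := by
    -- Two distinct sets of equal size each contain a point outside the other: a position a < u with
    -- `π a ∉ J` and a position b ≥ u with `π b ∈ J`, against the sorting.
    by_contra hne
    have h1 : ¬ (Finset.univ.filter fun j : Fin d => (j : ℕ) < u) ⊆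
        (Finset.univ.filter fun j : Fin d => π j ∈ J) := fun hss =>
      hne (Finset.eq_of_subset_of_card_le hss (by rw [hcard, hcard'])).symm
    have h2 : ¬ (Finset.univ.filter fun j : Fin d => π j ∈ J) ⊆
        (Finset.univ.filter fun j : Fin d => (j : ℕ) < u) := fun hss =>
      hne (Finset.eq_of_subset_of_card_le hss (by rw [hcard, hcard']))
    obtain ⟨a, ha, ha'⟩ := Finset.not_subset.1 h1
    obtain ⟨b, hb, hb'⟩ := Finset.not_subset.1 h2
    simp only [Finset.mem_filter, Finset.mem_univ, true_and] at ha ha' hb hb'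
    have hab : a ≤ b := by
      rw [Fin.le_def]; omega
    exact absurd (hπ hab) (not_le.2 (hf _ hb _ ha'))
  have := Finset.ext_iff.1 hsub j
  simpa using this.symm

/-- Frobenius distance of the projections onto the spans of corresponding parts of two orthonormal
bases. -/
lemma frobeniusNorm_projMatrix_sub_le {q : ℕ}
    (v w : OrthonormalBasis (Fin q) ℝ (EuclideanSpace ℝ (Fin q))) (J : Finset (Fin q))
    {R S : Submodule ℝ (EuclideanSpace ℝ (Fin q))}
    (hR : R = Submodule.span ℝ (v '' (J : Set (Fin q))))
    (hS : S = Submodule.span ℝ (w '' (J : Set (Fin q)))) {s : ℝ} (hs : 0 ≤ s)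
    (h : ∀ j ∈ J, 1 - ⟪v j, w j⟫ ^ 2 ≤ s ^ 2) :
    frobeniusNorm (projMatrix S - projMatrix R) ≤ Real.sqrt (2 * J.card) * s := by
  have hproj : ∀ (b : OrthonormalBasis (Fin q) ℝ (EuclideanSpace ℝ (Fin q)))
      (Q : Submodule ℝ (EuclideanSpace ℝ (Fin q))),
      Q = Submodule.span ℝ (b '' (J : Set (Fin q))) →
      ∀ i k, projMatrix Q i k = ∑ j ∈ J, b j i * b j k := by
    intro b Q hQ i k
    simp only [projMatrix, Matrix.of_apply]
    rw [starProjection_span_image b J Q hQ]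
    simp [EuclideanSpace.inner_single_right, mul_comm]
  have hdot : ∀ x y : EuclideanSpace ℝ (Fin q), ∑ i, x i * y i = ⟪x, y⟫ := fun x y => by
    simp [PiLp.inner_apply, mul_comm]
  have hcross : ∀ b b' : OrthonormalBasis (Fin q) ℝ (EuclideanSpace ℝ (Fin q)),
      ∑ i, ∑ k, (∑ j ∈ J, b j i * b j k) * (∑ j ∈ J, b' j i * b' j k) =
        ∑ j ∈ J, ∑ l ∈ J, ⟪b j, b' l⟫ ^ 2 := by
    intro b b'
    simp only [Finset.sum_mul_sum, ← hdot, sq]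
    have hswap : ∀ F : Fin q → Fin q → Fin q → ℝ,
        ∑ k, ∑ j ∈ J, ∑ l ∈ J, F k j l = ∑ j ∈ J, ∑ l ∈ J, ∑ k, F k j l := fun F => by
      rw [Finset.sum_comm]
      exact Finset.sum_congr rfl fun j _ => Finset.sum_comm
    rw [Finset.sum_congr rfl fun i _ => hswap _, hswap]
    refine Finset.sum_congr rfl fun j _ => Finset.sum_congr rfl fun l _ =>
      Finset.sum_congr rfl fun i _ => Finset.sum_congr rfl fun k _ => by ring
  have hself : ∀ b : OrthonormalBasis (Fin q) ℝ (EuclideanSpace ℝ (Fin q)),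
      ∑ j ∈ J, ∑ l ∈ J, ⟪b j, b l⟫ ^ 2 = J.card := fun b => by
    simp [b.inner_eq_ite]
  have hexp : ∑ i, ∑ k, (projMatrix S - projMatrix R) i k ^ 2 =
      2 * J.card - 2 * ∑ j ∈ J, ∑ l ∈ J, ⟪v j, w l⟫ ^ 2 := by
    have : ∀ i k, (projMatrix S - projMatrix R) i k ^ 2 =
        (∑ j ∈ J, w j i * w j k) * (∑ j ∈ J, w j i * w j k) +
        (∑ j ∈ J, v j i * v j k) * (∑ j ∈ J, v j i * v j k) -
        2 * ((∑ j ∈ J, v j i * v j k) * (∑ j ∈ J, w j i * w j k)) := fun i k => by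
      rw [Matrix.sub_apply, hproj w S hS, hproj v R hR]
      ring
    simp only [this, Finset.sum_sub_distrib, Finset.sum_add_distrib, ← Finset.mul_sum]
    rw [hcross, hcross, hcross, hself, hself]
    ring
  -- Off-diagonal squares are only discarded: keeping l = j already bounds the overlap of the two
  -- projections from below.
  have hdiag : ∑ j ∈ J, (1 - s ^ 2) ≤ ∑ j ∈ J, ∑ l ∈ J, ⟪v j, w l⟫ ^ 2 := by
    refine Finset.sum_le_sum fun j hj => ?_
    have := Finset.single_le_sum (f := fun l => ⟪v j, w l⟫ ^ 2) (fun l _ => sq_nonneg _) hj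
    have := h j hj
    simp only at *
    linarith
  rw [Finset.sum_const, nsmul_eq_mul] at hdiag
  rw [frobeniusNorm, hexp]
  refine Real.sqrt_le_iff.2 ⟨by positivity, ?_⟩
  rw [mul_pow, Real.sq_sqrt (by positivity)]
  linarith

/-! ### Matrices as operators on Euclidean space -/

lemma inner_toEuclideanCLM_symm {q : ℕ} {M : Matrix (Fin q) (Fin q) ℝ} (hM : M.transpose = M)
    (x y : EuclideanSpace ℝ (Fin q)) :
    ⟪Matrix.toEuclideanCLM (n := Fin q) (𝕜 := ℝ) M x, y⟫ =
      ⟪x, Matrix.toEuclideanCLM (n := Fin q) (𝕜 := ℝ) M y⟫ := by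
  rw [real_inner_comm, Matrix.inner_toEuclideanCLM, Matrix.inner_toEuclideanCLM,
    Matrix.dotProduct_mulVec, ← Matrix.mulVec_transpose, hM, dotProduct_comm]

lemma score_eq_inner {q : ℕ} (U : Matrix (Fin q) (Fin q) ℝ) (x : EuclideanSpace ℝ (Fin q)) :
    score U x = ⟪x, Matrix.toEuclideanCLM (n := Fin q) (𝕜 := ℝ) U x⟫ := by
  rw [Matrix.inner_toEuclideanCLM]
  simp [score, dotProduct, Matrix.mulVec, Finset.mul_sum, mul_assoc]

/-- Schur's test for a symmetric matrix. -/
lemma norm_toEuclideanCLM_le_of_sum_abs_le {q : ℕ} {D : Matrix (Fin q) (Fin q) ℝ}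
    (hD : D.transpose = D) {ε : ℝ} (hε : 0 ≤ ε) (h : ∀ i, ∑ j, |D i j| ≤ ε)
    (x : EuclideanSpace ℝ (Fin q)) :
    ‖Matrix.toEuclideanCLM (n := Fin q) (𝕜 := ℝ) D x‖ ≤ ε * ‖x‖ := by
  refine abs_le_of_sq_le_sq' ?_ (by positivity) |>.2
  rw [EuclideanSpace.real_norm_sq_eq, mul_pow, EuclideanSpace.real_norm_sq_eq]
  -- Cauchy–Schwarz with weights |D i j|. Summing over i then produces column sums, which symmetry
  -- turns back into row sums.
  have h1 : ∀ i, (Matrix.toEuclideanCLM (n := Fin q) (𝕜 := ℝ) D x) i ^ 2 ≤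
      ε * ∑ j, |D i j| * x j ^ 2 := by
    intro i
    have : (Matrix.toEuclideanCLM (n := Fin q) (𝕜 := ℝ) D x) i = ∑ j, D i j * x j := by
      rw [Matrix.ofLp_toEuclideanCLM]; rfl
    rw [this]
    refine (Finset.sum_sq_le_sum_mul_sum_of_sq_le_mul Finset.univ (f := fun j => |D i j|)
      (g := fun j => |D i j| * x j ^ 2) (fun j _ => abs_nonneg _) (fun j _ => by positivity)
      (fun j _ => ?_)).trans ?_
    · rw [mul_pow, ← sq_abs (D i j)]; exact le_of_eq (by ring)
    · exact mul_le_mul_of_nonneg_right (h i) (Finset.sum_nonneg fun j _ => by positivity)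
  refine (Finset.sum_le_sum fun i _ => h1 i).trans ?_
  rw [← Finset.mul_sum, Finset.sum_comm, sq, mul_assoc]
  refine mul_le_mul_of_nonneg_left ?_ hε
  rw [Finset.mul_sum]
  refine Finset.sum_le_sum fun j _ => ?_
  rw [← Finset.sum_mul]
  refine mul_le_mul_of_nonneg_right ?_ (sq_nonneg _)
  rw [← hD]
  exact h j

lemma toEuclideanCLM_projMatrix {q : ℕ} (R : Submodule ℝ (EuclideanSpace ℝ (Fin q))) :
    Matrix.toEuclideanCLM (n := Fin q) (𝕜 := ℝ) (projMatrix R) = R.starProjection := by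
  ext x i
  have hx : x = ∑ j, x j • EuclideanSpace.single j (1 : ℝ) := by
    ext k
    simp [Finset.sum_apply, Pi.single_apply]
  rw [Matrix.ofLp_toEuclideanCLM]
  conv_rhs => rw [hx]
  simp [Matrix.mulVec, dotProduct, projMatrix, mul_comm]

/-! ### Reducing subspaces, the envelope and its scores -/

lemma IsReducing.apply_mem {q : ℕ} {M : Matrix (Fin q) (Fin q) ℝ}
    {R : Submodule ℝ (EuclideanSpace ℝ (Fin q))} (h : IsReducing M R)
    {x : EuclideanSpace ℝ (Fin q)} (hx : x ∈ R) :
    Matrix.toEuclideanCLM (n := Fin q) (𝕜 := ℝ) M x ∈ R := by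
  have h1 := congrArg (Matrix.toEuclideanCLM (n := Fin q) (𝕜 := ℝ)) h
  simp only [map_add, map_mul, map_sub, map_one, toEuclideanCLM_projMatrix] at h1
  rw [h1]
  simp [Submodule.starProjection_eq_self_iff.2 hx]

/-- Invariance passes to intersections at once, so the envelope need not be shown to be reducing
itself; for symmetric M invariance is all that is needed later. -/
lemma envelope_apply_mem {q m : ℕ} {M : Matrix (Fin q) (Fin q) ℝ} {A : Matrix (Fin q) (Fin m) ℝ}
    {x : EuclideanSpace ℝ (Fin q)} (hx : x ∈ envelope M A) :
    Matrix.toEuclideanCLM (n := Fin q) (𝕜 := ℝ) M x ∈ envelope M A := by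
  rw [envelope, Submodule.mem_sInf] at hx ⊢
  exact fun R hR => hR.1.apply_mem (hx R hR)

lemma colSpan_le_envelope {q m : ℕ} (M : Matrix (Fin q) (Fin q) ℝ)
    (A : Matrix (Fin q) (Fin m) ℝ) : colSpan A ≤ envelope M A :=
  le_sInf fun _ hR => hR.2

/-- The score is the squared length of Aᵀx; this makes it nonnegative and makes it vanish on the
orthogonal complement of the column space. -/
lemma score_mul_transpose {q m : ℕ} (A : Matrix (Fin q) (Fin m) ℝ)
    (x : EuclideanSpace ℝ (Fin q)) :
    score (A * A.transpose) x = ∑ k, (∑ i, x i * A i k) ^ 2 := by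
  simp only [score, Matrix.mul_apply, Matrix.transpose_apply, Finset.mul_sum, Finset.sum_mul, sq]
  have hswap : ∀ F : Fin q → Fin q → Fin m → ℝ,
      ∑ i, ∑ j, ∑ k, F i j k = ∑ k, ∑ j, ∑ i, F i j k := fun F => by
    rw [Finset.sum_congr rfl fun i _ => Finset.sum_comm, Finset.sum_comm]
    exact Finset.sum_congr rfl fun k _ => Finset.sum_comm
  rw [hswap]
  refine Finset.sum_congr rfl fun k _ => Finset.sum_congr rfl fun j _ =>
    Finset.sum_congr rfl fun i _ => by ring

lemma score_eq_zero_of_mem_orthogonal {q m : ℕ} {A : Matrix (Fin q) (Fin m) ℝ}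
    {R : Submodule ℝ (EuclideanSpace ℝ (Fin q))} (hR : colSpan A ≤ R)
    {x : EuclideanSpace ℝ (Fin q)} (hx : x ∈ Rᗮ) : score (A * A.transpose) x = 0 := by
  rw [score_mul_transpose]
  refine Finset.sum_eq_zero fun k _ => ?_
  have h1 : WithLp.toLp 2 (fun i => A i k) ∈ R :=
    hR (Submodule.subset_span ⟨k, rfl⟩)
  have h2 := (Submodule.mem_orthogonal _ _).1 hx _ h1
  simp only [PiLp.inner_apply, RCLike.inner_apply, conj_trivial] at h2
  rw [h2, sq, mul_zero]

/-- Eigenvalues with index below `d` are separated from all others by the minimal gap. -/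
lemma IsMinEigenGap.le_abs_sub {q d : ℕ} {lam : Fin q → ℝ} {Δ : ℝ} (h : IsMinEigenGap lam d Δ)
    (hlam : Antitone lam) {j k : Fin q} (hj : (j : ℕ) < d) (hk : k ≠ j) :
    Δ ≤ |lam k - lam j| := by
  -- Any i as here shows that `eigenGaps lam d` is nonempty, so the degenerate case with arbitrary Δ
  -- never interferes.
  have hgap : ∀ (i : ℕ) (hi : i + 1 < q), i < d →
      Δ ≤ lam ⟨i, Nat.lt_of_succ_lt hi⟩ - lam ⟨i + 1, hi⟩ := fun i hi hid =>
    (h ⟨_, i, hi, hid, rfl⟩).2 ⟨i, hi, hid, rfl⟩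
  rcases lt_or_gt_of_ne hk with hkj | hkj
  · have h1 := hgap k (by omega) (by omega)
    have h2 : lam j ≤ lam ⟨k + 1, by omega⟩ := hlam (by rw [Fin.le_def]; exact hkj)
    exact (by linarith : Δ ≤ lam k - lam j).trans (le_abs_self _)
  · have h1 := hgap j (by omega) hj
    have h2 : lam k ≤ lam ⟨j + 1, by omega⟩ := hlam (by rw [Fin.le_def]; exact hkj)
    rw [abs_sub_comm]
    exact (by linarith : Δ ≤ lam j - lam k).trans (le_abs_self _)

/-- In the population setting, the envelope is spanned by a set of `u` of the first `d`
eigenvectors; these have scores at least `ΔU` and the other ones have score zero. -/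
lemma exists_envelope_eq_span {q m d u : ℕ} {M : Matrix (Fin q) (Fin q) ℝ}
    {A : Matrix (Fin q) (Fin m) ℝ} (hM : M.transpose = M) {Δ ΔU : ℝ} (hΔ : 0 < Δ)
    (hΔU : 0 < ΔU) (hd : d ≤ q) {lam : Fin q → ℝ}
    {v : OrthonormalBasis (Fin q) ℝ (EuclideanSpace ℝ (Fin q))} {π : Equiv.Perm (Fin d)}
    (hu : 1 ≤ u) (hrank : Module.finrank ℝ (envelope M A) = u) (hv : IsOrderedEigenbasis M lam v)
    (hle : envelope M A ≤ Submodule.span ℝ (Set.range fun j : Fin d => v (Fin.castLE hd j)))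
    (hgap : IsMinEigenGap lam d Δ) (hsort : SortsScores hd (A * A.transpose) v π)
    (hscore : ΔU = scoreGap hd (A * A.transpose) v π u) :
    ∃ J : Finset (Fin d), J.card = u ∧
      envelope M A = Submodule.span ℝ (v '' ((J.map (Fin.castLEEmb hd) : Finset (Fin q)) :
        Set (Fin q))) ∧
      (∀ j ∈ J, ΔU ≤ score (A * A.transpose) (v (Fin.castLE hd j))) ∧
      ∀ j ∉ J, score (A * A.transpose) (v (Fin.castLE hd j)) = 0 := by
  classical
  set R := envelope M A with hR
  have hsimple : ∀ j : Fin d, ∀ k, k ≠ Fin.castLE hd j → lam k ≠ lam (Fin.castLE hd j) :=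
    fun j k hk heq => by
      have := hgap.le_abs_sub hv.1 (j := Fin.castLE hd j) j.2 hk
      rw [heq, sub_self, abs_zero] at this
      linarith
  have hsym := inner_toEuclideanCLM_symm hM
  have hinv : ∀ x ∈ R, Matrix.toEuclideanCLM (n := Fin q) (𝕜 := ℝ) M x ∈ R :=
    fun x hx => envelope_apply_mem hx
  let J : Finset (Fin d) := Finset.univ.filter fun j => v (Fin.castLE hd j) ∈ R
  have hspan : R = Submodule.span ℝ (v '' ((J.map (Fin.castLEEmb hd) : Finset (Fin q)) :
      Set (Fin q))) := by
    have := eq_span_of_invariant hsym v hv.2 R hinv (Set.range (Fin.castLE hd))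
      (by rintro _ ⟨j, rfl⟩; exact hsimple j)
      (by rw [← Set.range_comp]; exact hle)
    refine this.trans ?_
    congr 2
    ext k
    simp only [Set.mem_ofPred_eq, Finset.coe_map, Set.mem_image, Finset.mem_coe, J,
      Finset.mem_filter, Finset.mem_univ, true_and, Set.mem_range, Fin.coe_castLEEmb]
    constructor
    · rintro ⟨⟨j, rfl⟩, h⟩
      exact ⟨j, h, rfl⟩
    · rintro ⟨j, h, rfl⟩
      exact ⟨⟨j, rfl⟩, h⟩
  have hcard : J.card = u := by
    rw [← hrank, hspan, Set.image_eq_range, finrank_span_eq_card]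
    · simp [Finset.card_image_of_injective _ (Fin.castLE_injective hd)]
    · exact v.orthonormal.linearIndependent.comp _ Subtype.val_injective
  have hzero : ∀ j ∉ J, score (A * A.transpose) (v (Fin.castLE hd j)) = 0 := by
    intro j hj
    refine score_eq_zero_of_mem_orthogonal (colSpan_le_envelope M A) ?_
    refine (mem_or_mem_orthogonal hsym v hv.2 R hinv _ (hsimple j)).resolve_left fun h => hj ?_
    simpa [J] using h
  have hnonneg : ∀ x, 0 ≤ score (A * A.transpose) x := fun x => by
    rw [score_mul_transpose]; positivity
  have hud : u ≤ d := by simpa [hcard] using Finset.card_le_univ J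
  refine ⟨J, hcard, hspan, ?_, hzero⟩
  rw [scoreGap, dif_pos (by omega)] at hscore
  -- The subtracted score is nonnegative (zero by convention if u = d), so the u-th largest score is
  -- itself at least ΔU.
  have hlast : 0 ≤ if h : u < d then
      score (A * A.transpose) (v (Fin.castLE hd (π ⟨u, h⟩))) else 0 := by
    split_ifs
    · exact hnonneg _
    · exact le_rfl
  have hfirst : ∀ j : Fin d, (j : ℕ) < u →
      ΔU ≤ score (A * A.transpose) (v (Fin.castLE hd (π j))) := fun j hj => by
    have : j ≤ ⟨u - 1, by omega⟩ := by rw [Fin.le_def]; simp only; omega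
    have h1 := hsort this
    simp only at h1
    linarith
  -- The first u sorted positions carry scores at least ΔU > 0, hence lie in J, and J has only u
  -- elements.
  have hsub : (Finset.univ.filter fun j : Fin d => (j : ℕ) < u).map π.toEmbedding ⊆ J := by
    intro k hk
    simp only [Finset.mem_map, Finset.mem_filter, Finset.mem_univ, true_and] at hk
    obtain ⟨j, hj, rfl⟩ := hk
    by_contra hJ
    have h1 := hfirst j hj
    have h2 := hzero _ hJ
    simp only [Equiv.coe_toEmbedding] at h2
    linarith
  have heq := Finset.eq_of_subset_of_card_le hsub (by
    rw [Finset.card_map, Fin.card_filter_val_lt, hcard, min_eq_right hud])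
  intro j hj
  rw [← heq] at hj
  simp only [Finset.mem_map, Finset.mem_filter, Finset.mem_univ, true_and] at hj
  obtain ⟨i, hi, rfl⟩ := hj
  exact hfirst i hi

/-! ### From row-sum errors to the error of NIECE -/

/-- Deterministic perturbation bound for NIECE. -/
theorem frobeniusNorm_nieceOutput_sub_le {q m d u : ℕ} {M Mhat : Matrix (Fin q) (Fin q) ℝ}
    {A Ahat : Matrix (Fin q) (Fin m) ℝ} (hM : M.transpose = M) (hMhat : Mhat.transpose = Mhat)
    {Δ ΔU ε : ℝ} (hpop : PopulationSetting M A d u Δ ΔU)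
    (hε : SmallEps ε Δ ΔU (opNorm (A * A.transpose)))
    (hMdiff : ∀ i, ∑ j, |(Mhat - M) i j| ≤ ε)
    (hUdiff : ∀ i, ∑ j, |(Ahat * Ahat.transpose - A * A.transpose) i j| ≤ ε / 2)
    {E : Submodule ℝ (EuclideanSpace ℝ (Fin q))}
    (hE : IsNieceOutput Mhat (Ahat * Ahat.transpose) d u E) :
    frobeniusNorm (projMatrix E - projMatrix (envelope M A)) ≤ 2 * Real.sqrt (2 * u) * ε / Δ := by
  classical
  obtain ⟨hu, hrank, hΔ, hd, lam, v, π, hv, hle, hgap, hsort, hscore⟩ := hpop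
  obtain ⟨_, mu, w, ρ, hw, hsort', rfl⟩ := hE
  obtain ⟨hε0, hεmin⟩ := hε
  obtain ⟨hεΔ, hεU⟩ := le_min_iff.1 hεmin
  set U := A * A.transpose with hU
  set Uhat := Ahat * Ahat.transpose with hUhat
  have hν : 0 ≤ opNorm U := norm_nonneg _
  have hUT : U.transpose = U := by simp [hU]
  have hUhatT : Uhat.transpose = Uhat := by simp [hUhat]
  have hden : 0 < 1 + 10 * opNorm U / Δ := by positivity
  have hεU' : ε * (1 + 10 * opNorm U / Δ) ≤ ΔU / 2 := by
    rwa [← div_eq_mul_inv, le_div_iff₀ hden] at hεU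
  have hΔU : 0 < ΔU := by
    have := mul_pos hε0 hden
    linarith
  obtain ⟨J, hJcard, hspan, hJ, hJc⟩ := exists_envelope_eq_span hM hΔ hΔU hd hu hrank hv hle hgap
    hsort hscore
  have hdiff : ∀ x, ‖Matrix.toEuclideanCLM (n := Fin q) (𝕜 := ℝ) Mhat x -
      Matrix.toEuclideanCLM (n := Fin q) (𝕜 := ℝ) M x‖ ≤ ε * ‖x‖ := fun x => by
    rw [← sub_apply, ← map_sub]
    exact norm_toEuclideanCLM_le_of_sum_abs_le (by simp [hM, hMhat]) hε0.le hMdiff x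
  have hdiff' : ∀ x, ‖Matrix.toEuclideanCLM (n := Fin q) (𝕜 := ℝ) M x -
      Matrix.toEuclideanCLM (n := Fin q) (𝕜 := ℝ) Mhat x‖ ≤ ε * ‖x‖ := fun x => by
    rw [norm_sub_rev]; exact hdiff x
  have hweyl : ∀ j, |lam j - mu j| ≤ ε := fun j => by
    have h1 := eigenvalue_le_add v w hv.2 hw.2 hv.1 hw.1 hdiff j
    have h2 := eigenvalue_le_add w v hw.2 hv.2 hw.1 hv.1 hdiff' j
    rw [abs_le]
    constructor <;> linarith
  have hsin : ∀ j : Fin d, 1 - ⟪v (Fin.castLE hd j), w (Fin.castLE hd j)⟫ ^ 2 ≤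
      (2 * ε / Δ) ^ 2 := fun j =>
    one_sub_inner_sq_le v w hv.2 hw.2 hΔ hεΔ hdiff _ (hweyl _)
      fun k hk => hgap.le_abs_sub hv.1 (j := Fin.castLE hd j) j.2 hk
  have hs1 : 2 * ε / Δ ≤ 1 := by rw [div_le_one hΔ]; linarith
  -- Rotating the eigenvector costs 4ν · 2ε/Δ and replacing U by Û costs ε/2; the sum is below ε(1 +
  -- 10ν/Δ) ≤ ΔU/2.
  have hscores : ∀ j : Fin d, |score Uhat (w (Fin.castLE hd j)) -
      score U (v (Fin.castLE hd j))| < ΔU / 2 := by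
    intro j
    have h1 := abs_quadratic_sub_le (inner_toEuclideanCLM_symm hUT)
      (v.norm_eq_one (Fin.castLE hd j)) (w.norm_eq_one (Fin.castLE hd j)) (by positivity) hs1
      (hsin j)
    have h2 : |⟪w (Fin.castLE hd j),
        Matrix.toEuclideanCLM (n := Fin q) (𝕜 := ℝ) (Uhat - U) (w (Fin.castLE hd j))⟫| ≤
        ε / 2 := by
      refine (abs_real_inner_le_norm _ _).trans ?_
      have := norm_toEuclideanCLM_le_of_sum_abs_le (by simp [hUT, hUhatT]) (by positivity) hUdiff
        (w (Fin.castLE hd j))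
      simpa using this
    rw [map_sub, sub_apply, inner_sub_right, ← score_eq_inner,
      ← score_eq_inner] at h2
    rw [← score_eq_inner, ← score_eq_inner] at h1
    have h3 := abs_sub_le (score Uhat (w (Fin.castLE hd j))) (score U (w (Fin.castLE hd j)))
      (score U (v (Fin.castLE hd j)))
    have h4 : 4 * opNorm U * (2 * ε / Δ) = ε * (8 * opNorm U / Δ) := by ring
    have h5 : ε * (8 * opNorm U / Δ) ≤ ε * (10 * opNorm U / Δ) := by gcongr; norm_num
    change _ ≤ 4 * opNorm U * (2 * ε / Δ) at h1
    linarith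
  -- Estimated scores exceed ΔU/2 on J and stay below it off J.
  have hsep : ∀ j ∈ J, ∀ k, k ∉ J →
      score Uhat (w (Fin.castLE hd k)) < score Uhat (w (Fin.castLE hd j)) := by
    intro j hj k hk
    have h1 := (abs_lt.1 (hscores j)).1
    have h2 := (abs_lt.1 (hscores k)).2
    rw [hJc k hk] at h2
    have h3 := hJ j hj
    linarith
  have hsorted := image_sort_eq (f := fun j => score Uhat (w (Fin.castLE hd j))) hsort' J hJcard
    hsep
  have hset : {x | ∃ j : Fin d, (j : ℕ) < u ∧ x = w (Fin.castLE hd (ρ j))} =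
      w '' ((J.map (Fin.castLEEmb hd) : Finset (Fin q)) : Set (Fin q)) := by
    ext x
    simp only [Set.mem_ofPred_eq, Finset.coe_map, Set.mem_image, Finset.mem_coe,
      exists_exists_and_eq_and, Fin.coe_castLEEmb]
    constructor
    · rintro ⟨j, hj, rfl⟩
      exact ⟨ρ j, (hsorted j).1 hj, rfl⟩
    · rintro ⟨k, hk, rfl⟩
      refine ⟨ρ.symm k, (hsorted _).2 (by simpa using hk), by simp⟩
  have hfrob := frobeniusNorm_projMatrix_sub_le v w (J.map (Fin.castLEEmb hd)) hspan
    (congrArg (Submodule.span ℝ) hset) (s := 2 * ε / Δ) (by positivity) (by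
      intro k hk
      obtain ⟨j, -, rfl⟩ := Finset.mem_map.1 hk
      exact hsin j)
  rw [Finset.card_map, hJcard] at hfrob
  refine hfrob.trans (le_of_eq ?_)
  ring

lemma sum_abs_le_colSumNorm {q m : ℕ} (A : Matrix (Fin q) (Fin m) ℝ) (j : Fin m) :
    ∑ i, |A i j| ≤ colSumNorm A :=
  le_ciSup (f := fun j => ∑ i, |A i j|) (Set.finite_range _).bddAbove j

lemma colSumNorm_nonneg {q m : ℕ} (A : Matrix (Fin q) (Fin m) ℝ) : 0 ≤ colSumNorm A :=
  Real.iSup_nonneg fun _ => Finset.sum_nonneg fun _ _ => abs_nonneg _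

lemma sum_abs_mul_le {q m l : ℕ} {B : Matrix (Fin q) (Fin m) ℝ} {C : Matrix (Fin m) (Fin l) ℝ}
    {b c : ℝ} (hc : 0 ≤ c) (hB : ∀ i, ∑ k, |B i k| ≤ b) (hC : ∀ k, ∑ j, |C k j| ≤ c)
    (i : Fin q) : ∑ j, |(B * C) i j| ≤ b * c := by
  calc ∑ j, |(B * C) i j| ≤ ∑ j, ∑ k, |B i k| * |C k j| := by
        refine Finset.sum_le_sum fun j _ => ?_
        rw [Matrix.mul_apply]
        refine (Finset.abs_sum_le_sum_abs _ _).trans (le_of_eq ?_)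
        simp [abs_mul]
    _ = ∑ k, |B i k| * ∑ j, |C k j| := by
        rw [Finset.sum_comm]; simp [Finset.mul_sum]
    _ ≤ ∑ k, |B i k| * c :=
        Finset.sum_le_sum fun k _ => mul_le_mul_of_nonneg_left (hC k) (abs_nonneg _)
    _ ≤ b * c := by
        rw [← Finset.sum_mul]; exact mul_le_mul_of_nonneg_right (hB i) hc

/-- Perturbation of `A Aᵀ` in row sums. -/
lemma sum_abs_mul_transpose_sub_le {q m : ℕ} {A Ahat : Matrix (Fin q) (Fin m) ℝ} {c δ : ℝ}
    (hc : 0 ≤ c) (hδ : 0 ≤ δ) (hrow : ∀ i, ∑ k, |A i k| ≤ c) (hcol : ∀ k, ∑ i, |A i k| ≤ c)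
    (hrow' : ∀ i, ∑ k, |(Ahat - A) i k| ≤ δ)
    (hcol' : ∀ k, ∑ i, |(Ahat.transpose - A.transpose) k i| ≤ δ) (i : Fin q) :
    ∑ j, |(Ahat * Ahat.transpose - A * A.transpose) i j| ≤ δ * (2 * c + δ) := by
  -- Row sums of Âᵀ are at most c + δ, so the two summands contribute δ(c + δ) and cδ.
  have hdecomp : Ahat * Ahat.transpose - A * A.transpose =
      (Ahat - A) * Ahat.transpose + A * (Ahat.transpose - A.transpose) := by
    rw [Matrix.sub_mul, Matrix.mul_sub]; abel
  have hAhat : ∀ k, ∑ j, |Ahat.transpose k j| ≤ c + δ := fun k => by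
    refine le_trans ?_ (add_le_add (hcol k) (hcol' k))
    rw [← Finset.sum_add_distrib]
    refine Finset.sum_le_sum fun j _ => ?_
    have := abs_add_le (A j k) ((Ahat.transpose - A.transpose) k j)
    simpa using this
  have h1 := sum_abs_mul_le (by positivity) hrow' hAhat i
  have h2 := sum_abs_mul_le hδ hrow hcol' i
  calc _ ≤ ∑ j, |((Ahat - A) * Ahat.transpose) i j| +
        ∑ j, |(A * (Ahat.transpose - A.transpose)) i j| := by
        rw [hdecomp, ← Finset.sum_add_distrib]
        exact Finset.sum_le_sum fun j _ => by rw [Matrix.add_apply]; exact abs_add_le _ _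
    _ ≤ _ := by linarith

/-! ### Exponential moments and Chernoff bounds -/

section ExponentialMoments

variable {Ω : Type*} [MeasurableSpace Ω] {μ : Measure Ω}

/-- `exp f` is integrable with integral at most `B`. -/
def ExpMomentLE (μ : Measure Ω) (f : Ω → ℝ) (B : ℝ) : Prop :=
  Integrable (fun ω => Real.exp (f ω)) μ ∧ ∫ ω, Real.exp (f ω) ∂μ ≤ B

/-- Domination supplies integrability together with the bound, so that monotonicity, averaging and
absolute values become pointwise inequalities. -/
lemma expMomentLE_of_exp_le {f g : Ω → ℝ} {B : ℝ} (hf : AEMeasurable f μ)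
    (hle : ∀ ω, Real.exp (f ω) ≤ g ω) (hg : Integrable g μ) (hB : ∫ ω, g ω ∂μ ≤ B) :
    ExpMomentLE μ f B := by
  have hint : Integrable (fun ω => Real.exp (f ω)) μ := by
    refine hg.mono' (Real.measurable_exp.comp_aemeasurable hf).aestronglyMeasurable
      (ae_of_all _ fun ω => ?_)
    rw [Real.norm_eq_abs, Real.abs_exp]
    exact hle ω
  exact ⟨hint, (integral_mono hint hg hle).trans hB⟩

lemma ExpMomentLE.mono {f g : Ω → ℝ} {B B' : ℝ} (h : ExpMomentLE μ g B) (hf : AEMeasurable f μ)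
    (hle : ∀ ω, f ω ≤ g ω) (hB : B ≤ B') : ExpMomentLE μ f B' :=
  expMomentLE_of_exp_le hf (fun ω => Real.exp_le_exp.2 (hle ω)) h.1 (h.2.trans hB)

lemma ExpMomentLE.add_const {g : Ω → ℝ} {B : ℝ} (h : ExpMomentLE μ g B) (c : ℝ) :
    ExpMomentLE μ (fun ω => g ω + c) (B * Real.exp c) := by
  simp only [ExpMomentLE, Real.exp_add]
  refine ⟨h.1.mul_const _, ?_⟩
  rw [integral_mul_const]
  exact mul_le_mul_of_nonneg_right h.2 (Real.exp_pos _).le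

/-- Convexity: the exponential moment of an average of two functions. -/
lemma ExpMomentLE.midpoint {f g : Ω → ℝ} {A B : ℝ} (hf : ExpMomentLE μ f A)
    (hg : ExpMomentLE μ g B) (hfm : AEMeasurable f μ) (hgm : AEMeasurable g μ) :
    ExpMomentLE μ (fun ω => (f ω + g ω) / 2) ((A + B) / 2) := by
  refine expMomentLE_of_exp_le (by fun_prop)
    (g := fun ω => (Real.exp (f ω) + Real.exp (g ω)) / 2) (fun ω => ?_)
    ((hf.1.add hg.1).div_const 2) ?_
  · have h1 : (f ω + g ω) / 2 = f ω / 2 + g ω / 2 := by ring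
    have h2 : Real.exp (f ω) = Real.exp (f ω / 2) * Real.exp (f ω / 2) := by
      rw [← Real.exp_add]; ring_nf
    have h3 : Real.exp (g ω) = Real.exp (g ω / 2) * Real.exp (g ω / 2) := by
      rw [← Real.exp_add]; ring_nf
    rw [h1, Real.exp_add, h2, h3]
    nlinarith [sq_nonneg (Real.exp (f ω / 2) - Real.exp (g ω / 2))]
  · rw [integral_div, integral_add hf.1 hg.1]
    linarith [hf.2, hg.2]

/-- Convexity: the exponential moment of an average of finitely many functions. -/
lemma expMomentLE_average {b : ℕ} (hb : 0 < b) {f : Fin b → Ω → ℝ} {B : ℝ}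
    (hf : ∀ j, AEMeasurable (f j) μ) (h : ∀ j, ExpMomentLE μ (f j) B) :
    ExpMomentLE μ (fun ω => (b : ℝ)⁻¹ * ∑ j, f j ω) B := by
  have hb' : (0 : ℝ) < b := by exact_mod_cast hb
  refine expMomentLE_of_exp_le (by fun_prop)
    (g := fun ω => (b : ℝ)⁻¹ * ∑ j, Real.exp (f j ω)) (fun ω => ?_)
    ((integrable_finsetSum _ fun j _ => (h j).1).const_mul _) ?_
  · have := convexOn_exp.map_sum_le (t := Finset.univ) (w := fun _ : Fin b => (b : ℝ)⁻¹)
      (p := fun j => f j ω) (fun _ _ => by positivity) (by simp [hb'.ne']) (fun _ _ => trivial)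
    simpa [Finset.mul_sum] using this
  · rw [integral_const_mul, integral_finsetSum _ fun j _ => (h j).1]
    calc (b : ℝ)⁻¹ * ∑ j, ∫ ω, Real.exp (f j ω) ∂μ ≤ (b : ℝ)⁻¹ * ∑ _j : Fin b, B := by
          gcongr with j _
          exact (h j).2
      _ = B := by simp [hb'.ne']

lemma ExpMomentLE.abs {g : Ω → ℝ} {A : ℝ} (hgm : AEMeasurable g μ) (h : ExpMomentLE μ g A)
    (h' : ExpMomentLE μ (fun ω => -g ω) A) : ExpMomentLE μ (fun ω => |g ω|) (2 * A) := by
  refine expMomentLE_of_exp_le (by fun_prop)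
    (g := fun ω => Real.exp (g ω) + Real.exp (-g ω)) (fun ω => ?_) (h.1.add h'.1) ?_
  · rcases abs_choice (g ω) with h | h <;> rw [h] <;>
      linarith [Real.exp_pos (g ω), Real.exp_pos (-g ω)]
  · rw [integral_add h.1 h'.1]
    linarith [h.2, h'.2]

/-- Chernoff's bound. -/
lemma measureReal_ge_le_of_expMomentLE [IsFiniteMeasure μ] {f : Ω → ℝ} {B l t : ℝ} (hl : 0 ≤ l)
    (h : ExpMomentLE μ (fun ω => l * f ω) B) : μ.real {ω | t ≤ f ω} ≤ Real.exp (-l * t) * B :=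
  (measure_ge_le_exp_mul_mgf t hl h.1).trans
    (mul_le_mul_of_nonneg_left h.2 (Real.exp_pos _).le)

/-- Sub-Gaussian tails imply an exponential moment of the square. -/
lemma expMomentLE_sq_of_tail [IsProbabilityMeasure μ] {Z : Ω → ℝ} (hZ : AEMeasurable Z μ) {s : ℝ}
    (hs : 0 < s) (h : ∀ t : ℝ, 0 ≤ t → μ.real {ω | t ≤ |Z ω|} ≤ 2 * Real.exp (-(t ^ 2 / s))) :
    ExpMomentLE μ (fun ω => Z ω ^ 2 / (2 * s)) 3 := by
  have hmeas : AEMeasurable (fun ω => Real.exp (Z ω ^ 2 / (2 * s))) μ := by fun_prop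
  have hnn : ∀ ω, 0 ≤ Real.exp (Z ω ^ 2 / (2 * s)) := fun ω => (Real.exp_pos _).le
  have hint2 : IntegrableOn (fun t : ℝ => 2 * t ^ (-2 : ℝ)) (Set.Ioi 1) :=
    (integrableOn_Ioi_rpow_of_lt (by norm_num) zero_lt_one).const_mul 2
  have hval : ∫ t in Set.Ioi (1 : ℝ), 2 * t ^ (-2 : ℝ) = 2 := by
    rw [integral_const_mul, integral_Ioi_rpow_of_lt (by norm_num) zero_lt_one]
    norm_num
  -- Layer cake: levels t ≤ 1 contribute at most 1. For t > 1 the tail at √(2s log t) is at most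
  -- 2t⁻², whose integral is 2; hence the constant 3.
  have hlint : ∫⁻ ω, ENNReal.ofReal (Real.exp (Z ω ^ 2 / (2 * s))) ∂μ ≤ ENNReal.ofReal 3 := by
    rw [lintegral_eq_lintegral_meas_le μ (ae_of_all _ hnn) hmeas,
      ← Set.Ioc_union_Ioi_eq_Ioi (zero_le_one' ℝ),
      lintegral_union measurableSet_Ioi (Set.Ioc_disjoint_Ioi le_rfl)]
    have h1 : ∫⁻ t in Set.Ioc (0 : ℝ) 1, μ {ω | t ≤ Real.exp (Z ω ^ 2 / (2 * s))} ≤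
        ENNReal.ofReal 1 := by
      refine (lintegral_mono fun t => prob_le_one).trans ?_
      simp
    have h2 : ∫⁻ t in Set.Ioi (1 : ℝ), μ {ω | t ≤ Real.exp (Z ω ^ 2 / (2 * s))} ≤
        ENNReal.ofReal 2 := by
      have h3 := ofReal_integral_eq_lintegral_ofReal hint2
        ((ae_restrict_iff' measurableSet_Ioi).2 (ae_of_all _ fun t ht => by
          have : (0 : ℝ) < t := zero_lt_one.trans ht
          positivity))
      rw [hval] at h3
      rw [h3]
      refine setLIntegral_mono' measurableSet_Ioi fun t ht => ?_
      have ht0 : (0 : ℝ) < t := zero_lt_one.trans ht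
      have hlog : 0 ≤ Real.log t := Real.log_nonneg (le_of_lt ht)
      rw [← ofReal_measureReal]
      refine ENNReal.ofReal_le_ofReal ?_
      refine (measureReal_mono (fun ω hω => ?_)).trans
        ((h (Real.sqrt (2 * s * Real.log t)) (Real.sqrt_nonneg _)).trans (le_of_eq ?_))
      · have h3 : Real.log t ≤ Z ω ^ 2 / (2 * s) := (Real.log_le_iff_le_exp ht0).2 hω
        rw [le_div_iff₀ (by positivity)] at h3
        exact Real.sqrt_le_iff.2 ⟨abs_nonneg _, by rw [sq_abs]; linarith⟩
      · rw [Real.sq_sqrt (by positivity), Real.rpow_def_of_pos ht0]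
        congr 2
        field_simp
    calc _ ≤ ENNReal.ofReal 1 + ENNReal.ofReal 2 := add_le_add h1 h2
      _ = ENNReal.ofReal 3 := by rw [← ENNReal.ofReal_add zero_le_one zero_le_two]; norm_num
  have hint : Integrable (fun ω => Real.exp (Z ω ^ 2 / (2 * s))) μ :=
    ⟨hmeas.aestronglyMeasurable, by
      rw [hasFiniteIntegral_iff_ofReal (ae_of_all _ hnn)]
      exact hlint.trans_lt ENNReal.ofReal_lt_top⟩
  refine ⟨hint, ?_⟩
  rw [integral_eq_lintegral_of_nonneg_ae (ae_of_all _ hnn) hmeas.aestronglyMeasurable]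
  exact ENNReal.toReal_le_of_le_ofReal (by norm_num) hlint

lemma abs_le_exp_sq (x : ℝ) : |x| ≤ Real.exp (x ^ 2) := by
  have := Real.add_one_le_exp (x ^ 2)
  rw [← sq_abs] at this ⊢
  nlinarith [sq_nonneg (|x| - 1)]

lemma ExpMomentLE.integrable_of_abs_le {f g : Ω → ℝ} {B : ℝ} (h : ExpMomentLE μ g B)
    (hf : AEMeasurable f μ) {c : ℝ} (hle : ∀ ω, |f ω| ≤ c * Real.exp (g ω)) (hc : 0 ≤ c) :
    Integrable f μ ∧ |∫ ω, f ω ∂μ| ≤ c * B := by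
  have hint : Integrable f μ := (h.1.const_mul c).mono' hf.aestronglyMeasurable (ae_of_all _ hle)
  refine ⟨hint, (abs_integral_le_integral_abs).trans ?_⟩
  refine (integral_mono hint.abs (h.1.const_mul c) hle).trans ?_
  rw [integral_const_mul]
  exact mul_le_mul_of_nonneg_left h.2 hc

/-- Centering preserves exponential moments of the square. -/
lemma ExpMomentLE.centered_sq {Z : Ω → ℝ} (hZ : AEMeasurable Z μ) {K B : ℝ} (hK : 0 < K)
    (h : ExpMomentLE μ (fun ω => Z ω ^ 2 / K) B) :
    Integrable Z μ ∧ ExpMomentLE μ (fun ω => (Z ω - ∫ ω', Z ω' ∂μ) ^ 2 / (2 * K))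
      (B * Real.exp (B ^ 2)) := by
  have h1 := h.integrable_of_abs_le hZ (c := Real.sqrt K) (fun ω => by
    have := abs_le_exp_sq (Z ω / Real.sqrt K)
    rw [abs_div, abs_of_nonneg (Real.sqrt_nonneg K), div_le_iff₀ (by positivity), div_pow,
      Real.sq_sqrt hK.le] at this
    linarith) (Real.sqrt_nonneg K)
  refine ⟨h1.1, ?_⟩
  set m := ∫ ω', Z ω' ∂μ
  refine (h.add_const (B ^ 2)).mono (by fun_prop) (fun ω => ?_) le_rfl
  -- By (Z − m)² ≤ 2Z² + 2m², doubling the scale K leaves only the additive constant m²/K ≤ B².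
  have hm : m ^ 2 ≤ K * B ^ 2 := by
    have := sq_le_sq' (by linarith [abs_nonneg m, h1.2]) h1.2
    rwa [sq_abs, mul_pow, Real.sq_sqrt hK.le] at this
  have e1 : Z ω ^ 2 / K + B ^ 2 = (Z ω ^ 2 + K * B ^ 2) / K := by field_simp
  rw [e1, div_le_div_iff₀ (by positivity) hK]
  nlinarith [sq_nonneg (Z ω + m), mul_pos hK hK]

/-- A centered product of two variables with square-exponential moments has exponential tails. -/
lemma ExpMomentLE.centered_mul [IsProbabilityMeasure μ] {Z W : Ω → ℝ} (hZ : AEMeasurable Z μ)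
    (hW : AEMeasurable W μ) {K B : ℝ} (hK : 0 < K)
    (h : ExpMomentLE μ (fun ω => Z ω ^ 2 / K) B) (h' : ExpMomentLE μ (fun ω => W ω ^ 2 / K) B) :
    Integrable (fun ω => Z ω * W ω) μ ∧
      ExpMomentLE μ (fun ω => |Z ω * W ω - ∫ ω', Z ω' * W ω' ∂μ| / K) (B * Real.exp B) := by
  -- |ZW| ≤ (Z² + W²)/2 makes this the midpoint of the two given moments.
  have h0 : ExpMomentLE μ (fun ω => |Z ω * W ω| / K) B := by
    refine (h.midpoint h' (by fun_prop) (by fun_prop)).mono (by fun_prop) (fun ω => ?_)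
      (by linarith)
    rw [← add_div, div_right_comm]
    gcongr
    rw [abs_mul]
    nlinarith [sq_nonneg (|Z ω| - |W ω|), sq_abs (Z ω), sq_abs (W ω)]
  have h1 := h0.integrable_of_abs_le (f := fun ω => Z ω * W ω) (by fun_prop) (c := K) (fun ω => by
    have := Real.add_one_le_exp (|Z ω * W ω| / K)
    have h2 : |Z ω * W ω| = K * (|Z ω * W ω| / K) := by field_simp
    nlinarith) hK.le
  refine ⟨h1.1, (h0.add_const B).mono (by fun_prop) (fun ω => ?_) le_rfl⟩
  rw [div_add' _ _ _ hK.ne']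
  gcongr
  refine (abs_sub _ _).trans ?_
  linarith [h1.2]

/-- A Taylor bound whose linear term disappears under the expectation of a centered variable,
leaving a remainder quadratic in the parameter. -/
lemma exp_le_one_add_add_sq_mul (x : ℝ) : Real.exp x ≤ 1 + x + x ^ 2 * Real.exp |x| := by
  have h1 := Real.add_one_le_exp (-x)
  have h2 : Real.exp (-x) * Real.exp x = 1 := by rw [← Real.exp_add]; simp
  have h3 := Real.exp_pos x
  have h4 : Real.exp x - 1 ≤ x * Real.exp x := by nlinarith
  rcases le_total 0 x with hx | hx
  · rw [abs_of_nonneg hx]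
    nlinarith
  · have h5 : 1 ≤ Real.exp |x| := Real.one_le_exp (abs_nonneg x)
    have h6 := Real.add_one_le_exp x
    nlinarith [sq_nonneg x]

/-- Moment generating function of a centered variable with exponential tails. -/
lemma expMomentLE_mul_of_integral_eq_zero [IsProbabilityMeasure μ] {ξ : Ω → ℝ}
    (hξ : AEMeasurable ξ μ) {K B : ℝ} (hK : 0 < K) (h : ExpMomentLE μ (fun ω => |ξ ω| / K) B)
    (hmean : ∫ ω, ξ ω ∂μ = 0) {θ : ℝ} (hθ : 2 * K * |θ| ≤ 1) :
    ExpMomentLE μ (fun ω => θ * ξ ω) (Real.exp (8 * K ^ 2 * B * θ ^ 2)) := by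
  have hint : Integrable ξ μ := (h.integrable_of_abs_le hξ (c := K) (fun ω => by
    have := Real.add_one_le_exp (|ξ ω| / K)
    have h2 : |ξ ω| = K * (|ξ ω| / K) := by field_simp
    nlinarith) hK.le).1
  have hint₁ : Integrable (fun ω => 1 + θ * ξ ω) μ := (integrable_const 1).add (hint.const_mul θ)
  have hint' : Integrable (fun ω => 8 * K ^ 2 * θ ^ 2 * Real.exp (|ξ ω| / K)) μ :=
    h.1.const_mul _
  refine expMomentLE_of_exp_le (by fun_prop)
    (g := fun ω => 1 + θ * ξ ω + 8 * K ^ 2 * θ ^ 2 * Real.exp (|ξ ω| / K)) (fun ω => ?_)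
    (hint₁.add hint') ?_
  · refine (exp_le_one_add_add_sq_mul _).trans ?_
    -- Half of the exponent |ξ|/K pays for the polynomial factor through y² ≤ 2eʸ, the other half
    -- for exp |θξ|.
    set y := |ξ ω| / (2 * K) with hy
    have hy0 : 0 ≤ y := by positivity
    have hξy : |ξ ω| = 2 * K * y := by rw [hy]; field_simp
    have e1 : (θ * ξ ω) ^ 2 = θ ^ 2 * (4 * K ^ 2 * y ^ 2) := by
      rw [mul_pow, ← sq_abs (ξ ω), hξy]; ring
    have e2 : |θ * ξ ω| ≤ y := by
      rw [abs_mul, hξy]; nlinarith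
    have e3 : y ^ 2 ≤ 2 * Real.exp y := by
      linarith [Real.quadratic_le_exp_of_nonneg hy0]
    have e4 : Real.exp (|ξ ω| / K) = Real.exp y * Real.exp y := by
      rw [← Real.exp_add, hξy]; congr 1; field_simp; ring
    have e5 : (θ * ξ ω) ^ 2 * Real.exp |θ * ξ ω| ≤
        θ ^ 2 * (4 * K ^ 2 * (2 * Real.exp y)) * Real.exp y := by
      rw [e1]
      gcongr
    rw [e4]
    linarith
  · rw [integral_add hint₁ hint',
      integral_add (integrable_const 1) (hint.const_mul θ), integral_const_mul,
      integral_const_mul, hmean]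
    have h1 : 8 * K ^ 2 * θ ^ 2 * ∫ ω, Real.exp (|ξ ω| / K) ∂μ ≤ 8 * K ^ 2 * θ ^ 2 * B :=
      mul_le_mul_of_nonneg_left h.2 (by positivity)
    have h2 := Real.add_one_le_exp (8 * K ^ 2 * B * θ ^ 2)
    simp only [integral_const, probReal_univ, smul_eq_mul]
    linarith

/-- Moment generating function of a centered sub-Gaussian variable. -/
lemma expMomentLE_mul_of_sq [IsProbabilityMeasure μ] {ζ : Ω → ℝ} (hζ : AEMeasurable ζ μ)
    {K B : ℝ} (hK : 0 < K) (h : ExpMomentLE μ (fun ω => ζ ω ^ 2 / K) B)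
    (hmean : ∫ ω, ζ ω ∂μ = 0) (θ : ℝ) :
    ExpMomentLE μ (fun ω => θ * ζ ω)
      (Real.exp (K * (8 * (B * Real.exp 1) + 4 * B + 1) * θ ^ 2)) := by
  have hB : 0 ≤ B := (integral_nonneg fun ω => (Real.exp_pos _).le).trans h.2
  have he := Real.exp_pos 1
  have hKs := Real.sq_sqrt hK.le
  have hK0 : 0 < Real.sqrt K := Real.sqrt_pos.2 hK
  -- Small θ: the previous lemma gives the term 8Be. Large θ: θζ ≤ ζ²/K + Kθ², and 1 ≤ 4Kθ² absorbs
  -- the factor B ≤ exp B, giving 4B + 1.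
  rcases le_or_gt (2 * Real.sqrt K * |θ|) 1 with hθ | hθ
  · have h1 : ExpMomentLE μ (fun ω => |ζ ω| / Real.sqrt K) (B * Real.exp 1) := by
      refine (h.add_const 1).mono (by fun_prop) (fun ω => ?_) le_rfl
      have e1 : ζ ω ^ 2 / K = (|ζ ω| / Real.sqrt K) ^ 2 := by rw [div_pow, sq_abs, hKs]
      rw [e1]
      nlinarith [sq_nonneg (|ζ ω| / Real.sqrt K - 1), sq_nonneg (|ζ ω| / Real.sqrt K)]
    refine (expMomentLE_mul_of_integral_eq_zero hζ hK0 h1 hmean hθ).mono (by fun_prop)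
      (fun ω => le_rfl) (Real.exp_le_exp.2 ?_)
    rw [hKs]
    have : 0 ≤ K * (4 * B + 1) * θ ^ 2 := by positivity
    nlinarith
  · have hθ2 : 1 ≤ 4 * K * θ ^ 2 := by
      have : 1 ≤ (2 * Real.sqrt K * |θ|) ^ 2 := one_le_pow₀ hθ.le
      rw [mul_pow, mul_pow, hKs, sq_abs] at this
      linarith
    refine (h.add_const (K * θ ^ 2)).mono (by fun_prop) (fun ω => ?_) ?_
    · have e1 : ζ ω ^ 2 / K = (ζ ω / Real.sqrt K) ^ 2 := by rw [div_pow, hKs]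
      have e2 : θ * ζ ω = (Real.sqrt K * θ) * (ζ ω / Real.sqrt K) := by field_simp
      have e3 : K * θ ^ 2 = (Real.sqrt K * θ) ^ 2 := by rw [mul_pow, hKs]
      rw [e1, e2, e3]
      nlinarith [sq_nonneg (Real.sqrt K * θ - ζ ω / Real.sqrt K),
        sq_nonneg (Real.sqrt K * θ), sq_nonneg (ζ ω / Real.sqrt K)]
    · have e1 : B ≤ Real.exp B := by linarith [Real.add_one_le_exp B]
      refine (mul_le_mul_of_nonneg_right e1 (Real.exp_pos _).le).trans ?_
      rw [← Real.exp_add]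
      refine Real.exp_le_exp.2 ?_
      have e2 : B * 1 ≤ B * (4 * K * θ ^ 2) := mul_le_mul_of_nonneg_left hθ2 hB
      have e3 : 0 ≤ K * (8 * (B * Real.exp 1)) * θ ^ 2 := by positivity
      nlinarith

/-- Moment generating function of a sum of independent variables. -/
lemma expMomentLE_mul_sum [IsProbabilityMeasure μ] {n : ℕ} {ξ : Fin n → Ω → ℝ}
    (hind : iIndepFun ξ μ) (hξ : ∀ k, AEMeasurable (ξ k) μ) {θ L : ℝ}
    (h : ∀ k, ExpMomentLE μ (fun ω => θ * ξ k ω) (Real.exp L)) :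
    ExpMomentLE μ (fun ω => θ * ∑ k, ξ k ω) (Real.exp (n * L)) := by
  have hmgf := hind.mgf_sum₀ (t := θ) hξ Finset.univ
  have hpos : 0 < mgf (∑ k, ξ k) μ θ := by
    rw [hmgf]
    exact Finset.prod_pos fun k _ => mgf_pos (h k).1
  have hle : mgf (∑ k, ξ k) μ θ ≤ Real.exp (n * L) := by
    rw [hmgf]
    refine (Finset.prod_le_prod (fun k _ => mgf_nonneg) fun k _ => (h k).2).trans ?_
    rw [Finset.prod_const, Finset.card_univ, Fintype.card_fin, Real.exp_nat_mul]
  simp only [mgf, Finset.sum_apply] at hpos hle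
  -- The Bochner integral of a non-integrable function is 0, so a positive integral already yields
  -- integrability.
  exact ⟨Integrable.of_integral_ne_zero hpos.ne', hle⟩

/-- The mean of independent centered sub-Gaussian variables has an exponential moment of its
square, at scale `n`. -/
lemma expMomentLE_sq_mean [IsProbabilityMeasure μ] {n : ℕ} (hn : 0 < n) {ζ : Fin n → Ω → ℝ}
    (hind : iIndepFun ζ μ) (hζ : ∀ k, AEMeasurable (ζ k) μ) {L : ℝ} (hL : 0 < L)
    (h : ∀ k θ, ExpMomentLE μ (fun ω => θ * ζ k ω) (Real.exp (L * θ ^ 2))) :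
    ExpMomentLE μ (fun ω => ((n : ℝ)⁻¹ * ∑ k, ζ k ω) ^ 2 / (2 * (4 * L / n))) 3 := by
  have hn' : (0 : ℝ) < n := by exact_mod_cast hn
  have hsum := fun θ => expMomentLE_mul_sum hind hζ (fun k => h k θ)
  refine expMomentLE_sq_of_tail (by fun_prop) (by positivity) fun t ht => ?_
  set S := fun ω => ∑ k, ζ k ω with hS
  -- The choice t/(2L) is the optimal Chernoff parameter for a log-moment Lθ² per summand.
  have hexp : -(t / (2 * L)) * (n * t) + n * (L * (t / (2 * L)) ^ 2) = -(t ^ 2 / (4 * L / n)) := by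
    field_simp
    ring
  have h1 : μ.real {ω | n * t ≤ S ω} ≤ Real.exp (-(t ^ 2 / (4 * L / n))) := by
    refine (measureReal_ge_le_of_expMomentLE (l := t / (2 * L)) (by positivity)
      (hsum (t / (2 * L)))).trans ?_
    rw [← Real.exp_add, hexp]
  have h2 : μ.real {ω | n * t ≤ -S ω} ≤ Real.exp (-(t ^ 2 / (4 * L / n))) := by
    refine (measureReal_ge_le_of_expMomentLE (l := t / (2 * L)) (by positivity)
      (B := Real.exp (n * (L * (t / (2 * L)) ^ 2))) ?_).trans ?_
    · have := hsum (-(t / (2 * L)))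
      rw [neg_sq] at this
      simpa only [neg_mul, mul_neg] using this
    · rw [← Real.exp_add, hexp]
  have hsub : {ω | t ≤ |(n : ℝ)⁻¹ * S ω|} ⊆ {ω | n * t ≤ S ω} ∪ {ω | n * t ≤ -S ω} := by
    intro ω hω
    have hω' : t ≤ |(n : ℝ)⁻¹ * S ω| := hω
    rw [abs_mul, abs_of_pos (by positivity), inv_mul_eq_div, le_div_iff₀ hn', mul_comm] at hω'
    exact le_abs.1 hω'
  refine (measureReal_mono hsub).trans ((measureReal_union_le _ _).trans ?_)
  linarith

end ExponentialMoments

/-! ### Concentration of sample covariances -/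

section SampleCovariance

variable {Ω : Type*} [MeasurableSpace Ω] {μ : Measure Ω}

lemma ExpMomentLE.of_identDistrib {f g : Ω → ℝ} {B : ℝ} (h : ExpMomentLE μ g B)
    (hfg : IdentDistrib f g μ μ) : ExpMomentLE μ f B := by
  have := hfg.comp Real.measurable_exp
  exact ⟨this.integrable_iff.2 h.1, this.integral_eq.trans_le h.2⟩

/-- The sample covariance of two real samples after centering at arbitrary points. -/
lemma sampleCov_eq_centered {n : ℕ} (hn : 0 < n) (z w : Fin n → ℝ) (a b c : ℝ) :
    (n : ℝ)⁻¹ * ∑ k, (z k - (n : ℝ)⁻¹ * ∑ l, z l) * (w k - (n : ℝ)⁻¹ * ∑ l, w l) - c =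
      (n : ℝ)⁻¹ * ∑ k, ((z k - a) * (w k - b) - c) -
        ((n : ℝ)⁻¹ * ∑ k, (z k - a)) * ((n : ℝ)⁻¹ * ∑ k, (w k - b)) := by
  have hn' : (n : ℝ) ≠ 0 := by exact_mod_cast hn.ne'
  simp only [sub_mul, mul_sub, Finset.sum_sub_distrib, ← Finset.sum_mul, ← Finset.mul_sum,
    Finset.sum_const, Finset.card_univ, Fintype.card_fin, nsmul_eq_mul]
  field_simp
  ring

/-- Exponential moments of the error of a sample covariance. -/
lemma expMomentLE_sampleCov_sub [IsProbabilityMeasure μ] {Z W : Ω → ℝ} (hZ : Measurable Z)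
    (hW : Measurable W) {K B : ℝ} (hK : 0 < K) (hZi : Integrable Z μ) (hWi : Integrable W μ)
    (hZe : ExpMomentLE μ (fun ω => (Z ω - ∫ ω', Z ω' ∂μ) ^ 2 / K) B)
    (hWe : ExpMomentLE μ (fun ω => (W ω - ∫ ω', W ω' ∂μ) ^ 2 / K) B)
    {n : ℕ} (hn : 0 < n) {z w : Fin n → Ω → ℝ}
    (hind : iIndepFun (fun k ω => (z k ω, w k ω)) μ)
    (hid : ∀ k, IdentDistrib (fun ω => (z k ω, w k ω)) (fun ω => (Z ω, W ω)) μ μ)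
    {θ : ℝ} (hθ : 0 ≤ θ) (hθ1 : 4 * K * θ ≤ n)
    (hθ2 : 16 * (K * (8 * (B * Real.exp 1) + 4 * B + 1)) * θ ≤ n) :
    ExpMomentLE μ (fun ω => θ * |(n : ℝ)⁻¹ * ∑ k, (z k ω - (n : ℝ)⁻¹ * ∑ l, z l ω) *
        (w k ω - (n : ℝ)⁻¹ * ∑ l, w l ω) - covariance Z W μ|)
      (5 / 2 * Real.exp (32 * K ^ 2 * (B * Real.exp B) * θ ^ 2 / n)) := by
  have hn' : (0 : ℝ) < n := by exact_mod_cast hn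
  have hB : 0 ≤ B := (integral_nonneg fun ω => (Real.exp_pos _).le).trans hZe.2
  have he := Real.exp_pos 1
  set L := K * (8 * (B * Real.exp 1) + 4 * B + 1) with hLdef
  have hL : 0 < L := by positivity
  set a := ∫ ω, Z ω ∂μ with ha
  set b := ∫ ω, W ω ∂μ with hb
  set c := covariance Z W μ with hc
  have hzm : ∀ k, AEMeasurable (z k) μ := fun k =>
    ((hid k).comp measurable_fst).aemeasurable_fst
  have hwm : ∀ k, AEMeasurable (w k) μ := fun k =>
    ((hid k).comp measurable_snd).aemeasurable_fst
  have hZ0 : ∫ ω, (Z ω - a) ∂μ = 0 := by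
    rw [integral_sub hZi (integrable_const _)]; simp [ha]
  have hW0 : ∫ ω, (W ω - b) ∂μ = 0 := by
    rw [integral_sub hWi (integrable_const _)]; simp [hb]
  have hprod := ExpMomentLE.centered_mul (Z := fun ω => Z ω - a) (W := fun ω => W ω - b)
    (by fun_prop) (by fun_prop) hK hZe hWe
  have hcint : ∫ ω, (Z ω - a) * (W ω - b) ∂μ = c := rfl
  rw [hcint] at hprod
  have hξ0 : ∫ ω, ((Z ω - a) * (W ω - b) - c) ∂μ = 0 := by
    rw [integral_sub hprod.1 (integrable_const _), hcint]; simp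
  set S := fun ω => ∑ k, ((z k ω - a) * (w k ω - b) - c) with hS
  set z' := fun ω => (n : ℝ)⁻¹ * ∑ k, (z k ω - a) with hz'
  set w' := fun ω => (n : ℝ)⁻¹ * ∑ k, (w k ω - b) with hw'
  have hSm : AEMeasurable S μ := by fun_prop
  have hz'm : AEMeasurable z' μ := by fun_prop
  have hw'm : AEMeasurable w' μ := by fun_prop
  -- The parameter is doubled because the error is later split as a midpoint of the product average
  -- and the two squared mean errors.
  have hSbound : ∀ τ : ℝ, |τ| = 2 * θ / n → ExpMomentLE μ (fun ω => τ * S ω)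
      (Real.exp (32 * K ^ 2 * (B * Real.exp B) * θ ^ 2 / n)) := by
    intro τ hτ
    have hg : Measurable fun x : ℝ × ℝ => (x.1 - a) * (x.2 - b) - c := by fun_prop
    have h1 := expMomentLE_mul_of_integral_eq_zero (θ := τ) (by fun_prop) hK hprod.2 hξ0 (by
      rw [hτ, mul_div_assoc', div_le_one hn']; linarith)
    have h2 := expMomentLE_mul_sum (hind.comp (fun _ => _) fun _ => hg) (θ := τ)
      (fun k => ((hid k).comp hg).aemeasurable_fst)
      (fun k => h1.of_identDistrib ((hid k).comp (hg.const_mul τ)))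
    refine h2.mono (by fun_prop) (fun ω => le_rfl) (Real.exp_le_exp.2 (le_of_eq ?_))
    rw [← sq_abs τ, hτ]
    field_simp
    ring
  have hmean : ∀ (g : ℝ × ℝ → ℝ) (hg : Measurable g), ∫ ω, g (Z ω, W ω) ∂μ = 0 →
      ExpMomentLE μ (fun ω => g (Z ω, W ω) ^ 2 / K) B →
      ExpMomentLE μ (fun ω => 2 * θ * ((n : ℝ)⁻¹ * ∑ k, g (z k ω, w k ω)) ^ 2) 3 := by
    intro g hg hg0 hge
    have hgm : ∀ k, AEMeasurable (fun ω => g (z k ω, w k ω)) μ := fun k =>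
      ((hid k).comp hg).aemeasurable_fst
    have h1 := expMomentLE_mul_of_sq (by fun_prop) hK hge hg0
    have h2 := expMomentLE_sq_mean hn (hind.comp (fun _ => g) fun _ => hg)
      (fun k => ((hid k).comp hg).aemeasurable_fst) hL
      (fun k τ => (h1 τ).of_identDistrib ((hid k).comp (hg.const_mul τ)))
    refine h2.mono (by fun_prop) (fun ω => ?_) le_rfl
    simp only [Function.comp_apply]
    rw [div_eq_inv_mul]
    refine mul_le_mul_of_nonneg_right ?_ (sq_nonneg _)
    rw [← one_div, le_div_iff₀ (by positivity), ← mul_div_assoc, ← mul_div_assoc,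
      div_le_one hn']
    linarith
  have hz2 := hmean (fun x => x.1 - a) (by fun_prop) hZ0 hZe
  have hw2 := hmean (fun x => x.2 - b) (by fun_prop) hW0 hWe
  have hτ : |2 * θ / n| = 2 * θ / n := abs_of_nonneg (by positivity)
  have hSabs := ExpMomentLE.abs (by fun_prop) (hSbound (2 * θ / n) hτ) (by
    have := hSbound (-(2 * θ / n)) (by rw [abs_neg, hτ])
    simpa only [neg_mul] using this)
  refine (hSabs.midpoint (hz2.midpoint hw2 (by fun_prop) (by fun_prop)) (by fun_prop)
    (by fun_prop)).mono (by fun_prop) (fun ω => ?_) ?_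
  · rw [sampleCov_eq_centered hn (fun k => z k ω) (fun k => w k ω) a b c]
    change θ * |(n : ℝ)⁻¹ * S ω - z' ω * w' ω| ≤
      (|2 * θ / n * S ω| + (2 * θ * z' ω ^ 2 + 2 * θ * w' ω ^ 2) / 2) / 2
    have e1 : |2 * θ / n * S ω| = 2 * θ * |(n : ℝ)⁻¹ * S ω| := by
      rw [abs_mul, hτ, abs_mul, abs_of_pos (inv_pos.2 hn')]; ring
    have e2 : |(n : ℝ)⁻¹ * S ω - z' ω * w' ω| ≤ |(n : ℝ)⁻¹ * S ω| + |z' ω * w' ω| := abs_sub _ _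
    have e3 : |z' ω * w' ω| ≤ (z' ω ^ 2 + w' ω ^ 2) / 2 := by
      rw [abs_mul]
      nlinarith [sq_nonneg (|z' ω| - |w' ω|), sq_abs (z' ω), sq_abs (w' ω)]
    rw [e1]
    have := mul_le_mul_of_nonneg_left (e2.trans (add_le_add_right e3 _)) hθ
    linarith
  -- The midpoint yields (2E + 3)/2 with E ≥ 1 the exponential, at most (5/2)E.
  · have : 1 ≤ Real.exp (32 * K ^ 2 * (B * Real.exp B) * θ ^ 2 / n) :=
      Real.one_le_exp (by positivity)
    linarith

/-- `Z` has tails `P(|Z| ≥ t) ≤ 2 exp(-t²/σ²)`. -/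
def HasSubGaussianTail (μ : Measure Ω) (Z : Ω → ℝ) (σ : ℝ) : Prop :=
  ∀ t : ℝ, 0 ≤ t → μ.real {ω | t ≤ |Z ω|} ≤ 2 * Real.exp (-(t ^ 2 / σ ^ 2))

/-- Concentration of the row sums of the error of a sample covariance matrix. -/
lemma exists_measureReal_rowSum_le (σ T : ℝ) (hσ : 0 < σ) (hT : 0 < T) :
    ∃ c : ℝ, 0 < c ∧ ∀ {Ω : Type*} [MeasurableSpace Ω] (μ : Measure Ω) [IsProbabilityMeasure μ]
      {n a b : ℕ} (V : Ω → Fin a → ℝ) (W : Ω → Fin b → ℝ)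
      (Vs : Fin n → Ω → Fin a → ℝ) (Ws : Fin n → Ω → Fin b → ℝ),
      0 < n → 0 < b → Measurable V → Measurable W →
      (∀ i, HasSubGaussianTail μ (fun ω => V ω i) σ) →
      (∀ j, HasSubGaussianTail μ (fun ω => W ω j) σ) →
      IsIIDSample μ V W Vs Ws → ∀ t : ℝ, 0 < t → t ≤ T →
      μ.real {ω | ∃ i, t < ∑ j, |(sampleCov (fun k => Vs k ω) (fun k => Ws k ω) -
          covMatrix μ V W) i j|} ≤
        a * (5 / 2 * Real.exp (-(c * (n * t ^ 2 / (b : ℝ) ^ 2)))) := by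
  -- Tails with σ² give a square moment 3 at scale 2σ²; centering doubles the scale and turns 3 into
  -- 3 exp(3²).
  set K : ℝ := 2 * (2 * σ ^ 2) with hKdef
  set B : ℝ := 3 * Real.exp (3 ^ 2) with hBdef
  set L := K * (8 * (B * Real.exp 1) + 4 * B + 1) with hL
  set C := 32 * K ^ 2 * (B * Real.exp B) with hC
  have hK : 0 < K := by positivity
  have hB : 0 < B := by positivity
  have hL0 : 0 < L := by positivity
  have hC0 : 0 < C := by positivity
  -- The first two entries keep θ below in the admissible range for all t ≤ T; the third makes the
  -- quadratic term at most half of the linear gain.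
  set κ := min (min (1 / (4 * K * T)) (1 / (16 * L * T))) (1 / (2 * C)) with hκdef
  have hκ : 0 < κ := by positivity
  have hκ1 : 4 * K * (κ * T) ≤ 1 := by
    have : κ ≤ 1 / (4 * K * T) := (min_le_left _ _).trans (min_le_left _ _)
    rw [le_div_iff₀ (by positivity)] at this
    linarith
  have hκ2 : 16 * L * (κ * T) ≤ 1 := by
    have : κ ≤ 1 / (16 * L * T) := (min_le_left _ _).trans (min_le_right _ _)
    rw [le_div_iff₀ (by positivity)] at this
    linarith
  have hκ3 : κ * (2 * C) ≤ 1 := by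
    have : κ ≤ 1 / (2 * C) := min_le_right _ _
    rwa [le_div_iff₀ (by positivity)] at this
  refine ⟨κ / 2, by positivity, ?_⟩
  intro Ω _ μ _ n a b V W Vs Ws hn hb hV hW hVt hWt hiid t ht htT
  have hn' : (0 : ℝ) < n := by exact_mod_cast hn
  have hb' : (0 : ℝ) < b := by exact_mod_cast hb
  have hb1 : (1 : ℝ) ≤ b := by exact_mod_cast hb
  have hVi : ∀ i, Measurable fun ω => V ω i := fun i => (measurable_pi_apply i).comp hV
  have hWi : ∀ j, Measurable fun ω => W ω j := fun j => (measurable_pi_apply j).comp hW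
  have hVc := fun i => (expMomentLE_sq_of_tail (hVi i).aemeasurable (by positivity)
    (hVt i)).centered_sq (hVi i).aemeasurable (by positivity)
  have hWc := fun j => (expMomentLE_sq_of_tail (hWi j).aemeasurable (by positivity)
    (hWt j)).centered_sq (hWi j).aemeasurable (by positivity)
  set θ := κ * n * t / b with hθ
  have hθn : κ * T * n ≥ θ := by
    rw [hθ, ge_iff_le, div_le_iff₀ hb']
    have : κ * n * t ≤ κ * n * T := by gcongr
    have h2 : κ * T * n * 1 ≤ κ * T * n * b := by gcongr
    linarith
  let D : Fin a → Fin b → Ω → ℝ := fun i j ω =>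
    (sampleCov (fun k => Vs k ω) (fun k => Ws k ω) - covMatrix μ V W) i j
  have hVm : ∀ k i, AEMeasurable (fun ω => Vs k ω i) μ := fun k i =>
    ((hiid.2 k).comp ((measurable_pi_apply i).comp measurable_fst)).aemeasurable_fst
  have hWm : ∀ k j, AEMeasurable (fun ω => Ws k ω j) μ := fun k j =>
    ((hiid.2 k).comp ((measurable_pi_apply j).comp measurable_snd)).aemeasurable_fst
  have hDm : ∀ i j, AEMeasurable (D i j) μ := fun i j => by
    simp only [D, sampleCov, sampleMean, Matrix.sub_apply, Matrix.of_apply]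
    fun_prop
  have hD : ∀ i j, ExpMomentLE μ (fun ω => θ * |D i j ω|)
      (5 / 2 * Real.exp (C * θ ^ 2 / n)) := by
    intro i j
    have hg : Measurable fun x : (Fin a → ℝ) × (Fin b → ℝ) => (x.1 i, x.2 j) := by fun_prop
    refine expMomentLE_sampleCov_sub (hVi i) (hWi j) hK (hVc i).1 (hWc j).1 (hVc i).2 (hWc j).2
      hn (z := fun k ω => Vs k ω i) (w := fun k ω => Ws k ω j)
      (hiid.1.comp (fun _ => _) fun _ => hg) (fun k => (hiid.2 k).comp hg) (by positivity) ?_ ?_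
    · have := mul_le_mul_of_nonneg_right hκ1 hn'.le
      nlinarith
    · have := mul_le_mul_of_nonneg_right hκ2 hn'.le
      change 16 * L * θ ≤ n
      nlinarith
  have hrow : ∀ i, μ.real {ω | t < ∑ j, |D i j ω|} ≤
      5 / 2 * Real.exp (-(κ / 2 * (n * t ^ 2 / (b : ℝ) ^ 2))) := by
    intro i
    -- Jensen over the b columns avoids a union bound over entries; the price is the parameter θ/b,
    -- hence b² in the exponent.
    have h1 := expMomentLE_average hb (fun j => by have := hDm i j; fun_prop) (hD i)
    have h2 : ExpMomentLE μ (fun ω => (θ / b) * ∑ j, |D i j ω|)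
        (5 / 2 * Real.exp (C * θ ^ 2 / n)) := by
      convert h1 using 2 with ω
      rw [← Finset.mul_sum]
      ring
    refine (measureReal_mono (fun ω (hω : t < _) => hω.le)).trans
      ((measureReal_ge_le_of_expMomentLE (t := t) (by positivity) h2).trans ?_)
    rw [mul_left_comm, ← Real.exp_add]
    refine mul_le_mul_of_nonneg_left (Real.exp_le_exp.2 ?_) (by norm_num)
    have e1 : -(θ / b) * t + C * θ ^ 2 / n =
        (-κ + κ * (2 * C) * (κ / 2)) * (n * t ^ 2 / (b : ℝ) ^ 2) := by
      rw [hθ]; field_simp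
    have e2 : 0 ≤ n * t ^ 2 / (b : ℝ) ^ 2 := by positivity
    rw [e1, ← neg_mul]
    refine mul_le_mul_of_nonneg_right ?_ e2
    nlinarith
  calc μ.real {ω | ∃ i, t < ∑ j, |D i j ω|} = μ.real (⋃ i, {ω | t < ∑ j, |D i j ω|}) := by
        congr 1; ext ω; simp
    _ ≤ ∑ i, μ.real {ω | t < ∑ j, |D i j ω|} := measureReal_iUnion_fintype_le _
    _ ≤ ∑ _i : Fin a, 5 / 2 * Real.exp (-(κ / 2 * (n * t ^ 2 / (b : ℝ) ^ 2))) :=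
        Finset.sum_le_sum fun i _ => hrow i
    _ = _ := by simp

end SampleCovariance

/-! ### Application to the NIECE estimator -/

lemma IsJointlySubGaussian.fst {Ω : Type*} [MeasurableSpace Ω] {P : Measure Ω} {p r : ℕ}
    {X : Ω → Fin p → ℝ} {Y : Ω → Fin r → ℝ} {σ : ℝ} (h : IsJointlySubGaussian P X Y σ)
    (i : Fin p) : HasSubGaussianTail P (fun ω => X ω i) σ := fun t ht => by
  simpa [Pi.single_apply] using h (Pi.single i 1) 0 (by simp [Pi.single_apply]) t ht

lemma IsJointlySubGaussian.snd {Ω : Type*} [MeasurableSpace Ω] {P : Measure Ω} {p r : ℕ}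
    {X : Ω → Fin p → ℝ} {Y : Ω → Fin r → ℝ} {σ : ℝ} (h : IsJointlySubGaussian P X Y σ)
    (j : Fin r) : HasSubGaussianTail P (fun ω => Y ω j) σ := fun t ht => by
  simpa [Pi.single_apply] using h 0 (Pi.single j 1) (by simp [Pi.single_apply]) t ht

/-- Provides the samples of (V, V) and (W, V) and the exchange of X and Y, so that one concentration
bound serves all matrices. -/
lemma IsIIDSample.comp {Ω : Type*} [MeasurableSpace Ω] {P : Measure Ω} {n p r p' r' : ℕ}
    {X : Ω → Fin p → ℝ} {Y : Ω → Fin r → ℝ} {Xs : Fin n → Ω → Fin p → ℝ}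
    {Ys : Fin n → Ω → Fin r → ℝ} (h : IsIIDSample P X Y Xs Ys)
    {f : (Fin p → ℝ) × (Fin r → ℝ) → Fin p' → ℝ} {g : (Fin p → ℝ) × (Fin r → ℝ) → Fin r' → ℝ}
    (hf : Measurable f) (hg : Measurable g) :
    IsIIDSample P (fun ω => f (X ω, Y ω)) (fun ω => g (X ω, Y ω))
      (fun k ω => f (Xs k ω, Ys k ω)) (fun k ω => g (Xs k ω, Ys k ω)) :=
  ⟨h.1.comp (fun _ x => (f x, g x)) fun _ => hf.prodMk hg,
    fun k => (h.2 k).comp (hf.prodMk hg)⟩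

lemma covMatrix_transpose {Ω : Type*} [MeasurableSpace Ω] (P : Measure Ω) {a b : ℕ}
    (V : Ω → Fin a → ℝ) (W : Ω → Fin b → ℝ) :
    (covMatrix P V W).transpose = covMatrix P W V := by
  ext i j
  simp [covMatrix, covariance_comm]

lemma sampleCov_transpose {n a b : ℕ} (V : Fin n → Fin a → ℝ) (W : Fin n → Fin b → ℝ) :
    (sampleCov V W).transpose = sampleCov W V := by
  ext i j
  simp [sampleCov, mul_comm]

/-- The sample is only a.e. measurable, so the bad set is enlarged to a measurable hull of the same
probability. -/
lemma nieceErrorAtMost_of_measureReal_le {Ω : Type*} [MeasurableSpace Ω] {P : Measure Ω}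
    [IsProbabilityMeasure P] {q : ℕ} {Mhat Uhat : Ω → Matrix (Fin q) (Fin q) ℝ} {d u : ℕ}
    {ℰ : Submodule ℝ (EuclideanSpace ℝ (Fin q))} {δ b : ℝ} (S : Set Ω) (hS : P.real S ≤ 1 - b)
    (h : ∀ ω, ω ∉ S → ∀ E, IsNieceOutput (Mhat ω) (Uhat ω) d u E →
      frobeniusNorm (projMatrix E - projMatrix ℰ) ≤ δ) :
    NieceErrorAtMost P Mhat Uhat d u ℰ δ b := by
  refine ⟨(toMeasurable P S)ᶜ, (measurableSet_toMeasurable P S).compl, ?_,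
    fun ω hω => h ω fun hS => hω (subset_toMeasurable P S hS)⟩
  rw [probReal_compl_eq_one_sub (measurableSet_toMeasurable P S), measureReal_def,
    measure_toMeasurable, ← measureReal_def]
  linarith

lemma NieceErrorAtMost.mono {Ω : Type*} [MeasurableSpace Ω] {P : Measure Ω}
    {q : ℕ} {Mhat Uhat : Ω → Matrix (Fin q) (Fin q) ℝ} {d u : ℕ}
    {ℰ : Submodule ℝ (EuclideanSpace ℝ (Fin q))} {δ b b' : ℝ}
    (h : NieceErrorAtMost P Mhat Uhat d u ℰ δ b) (hb : b' ≤ b) :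
    NieceErrorAtMost P Mhat Uhat d u ℰ δ b' :=
  let ⟨S, hS, hb', h⟩ := h
  ⟨S, hS, hb.trans hb', h⟩

/-- The error bound for NIECE applied to the marginal covariance of `V` and the cross-covariance of
`V` and `W`. -/
lemma exists_nieceErrorAtMost (σ c₁ : ℝ) (hσ : 0 < σ) (hc₁ : 0 < c₁) :
    ∃ c : ℝ, 0 < c ∧ ∀ {Ω : Type*} [MeasurableSpace Ω] (P : Measure Ω) [IsProbabilityMeasure P]
      {n q m : ℕ} (V : Ω → Fin q → ℝ) (W : Ω → Fin m → ℝ)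
      (Vs : Fin n → Ω → Fin q → ℝ) (Ws : Fin n → Ω → Fin m → ℝ),
      0 < n → 0 < q → 0 < m → Measurable V → Measurable W →
      (∀ i, HasSubGaussianTail P (fun ω => V ω i) σ) →
      (∀ j, HasSubGaussianTail P (fun ω => W ω j) σ) →
      IsIIDSample P V W Vs Ws →
      ∀ (d u : ℕ) (Δ ΔU ε : ℝ),
        ε ≤ colSumNorm (covMatrix P V W) + colSumNorm (covMatrix P W V) →
        colSumNorm (covMatrix P V W) + colSumNorm (covMatrix P W V) < c₁ →
        PopulationSetting (covMatrix P V V) (covMatrix P V W) d u Δ ΔU →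
        SmallEps ε Δ ΔU (opNorm (covMatrix P V W * covMatrix P W V)) →
        NieceErrorAtMost P
          (fun ω => sampleCov (fun k => Vs k ω) (fun k => Vs k ω))
          (fun ω => sampleCov (fun k => Vs k ω) (fun k => Ws k ω)
            * sampleCov (fun k => Ws k ω) (fun k => Vs k ω))
          d u (envelope (covMatrix P V V) (covMatrix P V W))
          (2 * Real.sqrt (2 * u) * ε / Δ)
          (1 - 5 / 2 * (q * Real.exp (-(c * (n * ε ^ 2 / (q : ℝ) ^ 2))) +
            q * Real.exp (-(c * (n * ε ^ 2 / (m : ℝ) ^ 2))) +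
            m * Real.exp (-(c * (n * ε ^ 2 / (q : ℝ) ^ 2))))) := by
  obtain ⟨c, hc, hrow⟩ := exists_measureReal_rowSum_le σ c₁ hσ hc₁
  -- Deviations of size κε perturb A Aᵀ by at most κε(2c₁ + κε) ≤ 3c₁κε ≤ ε/2.
  set κ := min 1 (1 / (6 * c₁)) with hκdef
  have hκ : 0 < κ := by positivity
  have hκ1 : κ ≤ 1 := min_le_left _ _
  have hκ2 : κ * (6 * c₁) ≤ 1 := by
    have : κ ≤ 1 / (6 * c₁) := min_le_right _ _
    rwa [le_div_iff₀ (by positivity)] at this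
  refine ⟨c * κ ^ 2, by positivity, ?_⟩
  intro Ω _ P _ n q m V W Vs Ws hn hq hm hV hW hVt hWt hiid d u Δ ΔU ε hε hcov hpop hsmall
  have hε0 : 0 < ε := hsmall.1
  have hεc : ε < c₁ := hε.trans_lt hcov
  have ht0 : 0 < κ * ε := by positivity
  have htε : κ * ε ≤ ε := by nlinarith
  have htT : κ * ε ≤ c₁ := htε.trans hεc.le
  have hVV : IsIIDSample P V V Vs Vs := hiid.comp measurable_fst measurable_fst
  have hWV : IsIIDSample P W V Ws Vs := hiid.comp measurable_snd measurable_fst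
  have b1 := hrow P V V Vs Vs hn hq hV hV hVt hVt hVV _ ht0 htT
  have b2 := hrow P V W Vs Ws hn hm hV hW hVt hWt hiid _ ht0 htT
  have b3 := hrow P W V Ws Vs hn hq hW hV hWt hVt hWV _ ht0 htT
  have hexp : ∀ x : ℝ, c * (n * (κ * ε) ^ 2 / x) = c * κ ^ 2 * (n * ε ^ 2 / x) := fun x => by ring
  rw [hexp] at b1 b2 b3
  set S1 := {ω | ∃ i, κ * ε < ∑ j, |(sampleCov (fun k => Vs k ω) (fun k => Vs k ω) -
    covMatrix P V V) i j|} with hS1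
  set S2 := {ω | ∃ i, κ * ε < ∑ j, |(sampleCov (fun k => Vs k ω) (fun k => Ws k ω) -
    covMatrix P V W) i j|} with hS2
  -- Row sums here are the column sums of the error of Â, needed for Âᵀ in Û.
  set S3 := {ω | ∃ i, κ * ε < ∑ j, |(sampleCov (fun k => Ws k ω) (fun k => Vs k ω) -
    covMatrix P W V) i j|} with hS3
  refine nieceErrorAtMost_of_measureReal_le (S1 ∪ S2 ∪ S3) ?_ ?_
  · have h1 := measureReal_union_le (μ := P) (S1 ∪ S2) S3
    have h2 := measureReal_union_le (μ := P) S1 S2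
    linarith
  · intro ω hω E hE
    simp only [Set.mem_union, not_or, hS1, hS2, hS3, Set.mem_ofPred_eq, not_exists, not_lt] at hω
    obtain ⟨⟨h1, h2⟩, h3⟩ := hω
    rw [← covMatrix_transpose P V W] at hsmall
    rw [← sampleCov_transpose (fun k => Vs k ω) (fun k => Ws k ω)] at hE
    refine frobeniusNorm_nieceOutput_sub_le (covMatrix_transpose P V V) (sampleCov_transpose _ _)
      hpop hsmall (fun i => (h1 i).trans htε) (fun i => ?_) hE
    have hn1 := colSumNorm_nonneg (covMatrix P V W)
    have hn2 := colSumNorm_nonneg (covMatrix P W V)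
    refine (sum_abs_mul_transpose_sub_le (c := c₁) hc₁.le ht0.le (fun i => ?_) (fun k => ?_) h2
      (fun k => ?_) i).trans ?_
    · have := sum_abs_le_colSumNorm (covMatrix P W V) i
      rw [← covMatrix_transpose P V W] at this
      simp only [Matrix.transpose_apply] at this
      rw [covMatrix_transpose] at this
      linarith
    · linarith [sum_abs_le_colSumNorm (covMatrix P V W) k]
    · rw [covMatrix_transpose, sampleCov_transpose]
      exact h3 k
    · have : κ * ε * (2 * c₁ + κ * ε) ≤ κ * ε * (3 * c₁) := by
        refine mul_le_mul_of_nonneg_left ?_ ht0.le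
        linarith
      nlinarith

/-- If p or r is 0, both norms are suprema over an empty index or of empty sums, hence 0; a positive
ε below their sum excludes this. -/
lemma pos_of_colSumNorm_pos {p r : ℕ} {A : Matrix (Fin p) (Fin r) ℝ}
    {B : Matrix (Fin r) (Fin p) ℝ} (h : 0 < colSumNorm A + colSumNorm B) : 0 < p ∧ 0 < r := by
  constructor <;> rw [Nat.pos_iff_ne_zero] <;> rintro rfl <;> simp [colSumNorm] at h

lemma nieceErrorAtMost_of_nonpos {Ω : Type*} [MeasurableSpace Ω] {P : Measure Ω} {q : ℕ}
    {Mhat Uhat : Ω → Matrix (Fin q) (Fin q) ℝ} {d u : ℕ}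
    {ℰ : Submodule ℝ (EuclideanSpace ℝ (Fin q))} {δ b : ℝ} (hb : b ≤ 0) :
    NieceErrorAtMost P Mhat Uhat d u ℰ δ b :=
  ⟨∅, MeasurableSet.empty, by simpa using hb, fun _ h => h.elim⟩

/-- For an empty sample all exponentials equal 1 and C r² ≥ 1, so the claim is vacuous there. -/
lemma probBound_zero_nonpos {C c ε : ℝ} (hC : 1 ≤ C) {p r : ℕ} (hr : 0 < r) :
    probBound C c 0 p r ε ≤ 0 := by
  have hr' : (1 : ℝ) ≤ r := by exact_mod_cast hr
  have h1 : (1 : ℝ) ≤ (r : ℝ) ^ 2 := one_le_pow₀ hr'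
  have h2 : 1 * 1 ≤ C * (r : ℝ) ^ 2 := by gcongr
  have h3 : 0 ≤ C * ((p : ℝ) * r) := by positivity
  simp only [probBound, Nat.cast_zero, zero_mul, zero_div, mul_zero, neg_zero, Real.exp_zero,
    mul_one]
  linarith

end Niece

theorem theorem2 (σ c₁ : ℝ) (hσ : 0 < σ) (hc₁ : 0 < c₁) :
    ∃ C : ℝ, 0 < C ∧ ∃ c : ℝ, 0 < c ∧
      ∀ (n p r : ℕ) (Ω : Type*) [MeasurableSpace Ω] (P : Measure Ω) [IsProbabilityMeasure P]
        (X : Ω → Fin p → ℝ) (Y : Ω → Fin r → ℝ)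
        (Xs : Fin n → Ω → Fin p → ℝ) (Ys : Fin n → Ω → Fin r → ℝ),
        Measurable X → Measurable Y →
        Niece.IsLinearModel P X Y →
        Niece.IsJointlySubGaussian P X Y σ →
        Niece.IsIIDSample P X Y Xs Ys →
        ∀ (d u : ℕ) (Δ ΔU ε : ℝ),
          ε ≤ Niece.colSumNorm (Niece.covMatrix P X Y)
              + Niece.colSumNorm (Niece.covMatrix P Y X) →
          Niece.colSumNorm (Niece.covMatrix P X Y)
              + Niece.colSumNorm (Niece.covMatrix P Y X) < c₁ →
          -- response envelope
          (Niece.PopulationSetting (Niece.covMatrix P Y Y) (Niece.covMatrix P Y X) d u Δ ΔU →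
            Niece.SmallEps ε Δ ΔU
              (Niece.opNorm (Niece.covMatrix P Y X * Niece.covMatrix P X Y)) →
            Niece.NieceErrorAtMost P
              (fun ω => Niece.sampleCov (fun k => Ys k ω) (fun k => Ys k ω))
              (fun ω => Niece.sampleCov (fun k => Ys k ω) (fun k => Xs k ω)
                * Niece.sampleCov (fun k => Xs k ω) (fun k => Ys k ω))
              d u (Niece.envelope (Niece.covMatrix P Y Y) (Niece.covMatrix P Y X))
              (2 * Real.sqrt (2 * u) * ε / Δ)
              (Niece.probBound C c n p r ε)) ∧
          -- predictor envelope
          (Niece.PopulationSetting (Niece.covMatrix P X X) (Niece.covMatrix P X Y) d u Δ ΔU →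
            Niece.SmallEps ε Δ ΔU
              (Niece.opNorm (Niece.covMatrix P X Y * Niece.covMatrix P Y X)) →
            Niece.NieceErrorAtMost P
              (fun ω => Niece.sampleCov (fun k => Xs k ω) (fun k => Xs k ω))
              (fun ω => Niece.sampleCov (fun k => Xs k ω) (fun k => Ys k ω)
                * Niece.sampleCov (fun k => Ys k ω) (fun k => Xs k ω))
              d u (Niece.envelope (Niece.covMatrix P X X) (Niece.covMatrix P X Y))
              (2 * Real.sqrt (2 * u) * ε / Δ)
              (max (Niece.probBound C c n p r ε) (Niece.probBound C c n r p ε))) := by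
  obtain ⟨c, hc, hmain⟩ := Niece.exists_nieceErrorAtMost σ c₁ hσ hc₁
  -- Twice 5/2: in the predictor case both p·ep and r·ep are absorbed into the single term pr·ep.
  refine ⟨5, by norm_num, c, hc, ?_⟩
  intro n p r Ω _ P _ X Y Xs Ys hX hY _ hsub hiid d u Δ ΔU ε hε hcov
  have hswap : Niece.IsIIDSample P Y X Ys Xs := hiid.comp measurable_snd measurable_fst
  have hpos : 0 < ε → (1 : ℝ) ≤ p ∧ (1 : ℝ) ≤ r ∧ 0 < p ∧ 0 < r := fun h0 => by
    obtain ⟨hp, hr⟩ := Niece.pos_of_colSumNorm_pos (h0.trans_le hε)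
    exact ⟨by exact_mod_cast hp, by exact_mod_cast hr, hp, hr⟩
  set ep := Real.exp (-(c * (n * ε ^ 2 / (p : ℝ) ^ 2))) with hep
  set er := Real.exp (-(c * (n * ε ^ 2 / (r : ℝ) ^ 2))) with her
  have hep0 : 0 < ep := Real.exp_pos _
  have her0 : 0 < er := Real.exp_pos _
  constructor
  · intro hpop hsmall
    obtain ⟨hp1, hr1, hp, hr⟩ := hpos hsmall.1
    rcases Nat.eq_zero_or_pos n with rfl | hn
    · exact Niece.nieceErrorAtMost_of_nonpos (Niece.probBound_zero_nonpos (by norm_num) hr)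
    · refine (hmain P Y X Ys Xs hn hr hp hY hX hsub.snd hsub.fst hswap d u Δ ΔU ε
        (by rwa [add_comm]) (by rwa [add_comm]) hpop hsmall).mono ?_
      rw [Niece.probBound, ← hep, ← her]
      have h1 : (r : ℝ) * er ≤ r ^ 2 * er := by gcongr; nlinarith
      have h2 : (r : ℝ) * ep ≤ p * r * ep := by gcongr; nlinarith
      have h3 : (p : ℝ) * er ≤ p * r * er := by gcongr; nlinarith
      have h4 : 0 < (r : ℝ) * er := by positivity
      have h5 : 0 < (r : ℝ) * ep := by positivity
      have h6 : 0 < (p : ℝ) * er := by positivity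
      linarith
  · intro hpop hsmall
    obtain ⟨hp1, hr1, hp, hr⟩ := hpos hsmall.1
    rcases Nat.eq_zero_or_pos n with rfl | hn
    · exact Niece.nieceErrorAtMost_of_nonpos (max_le
        (Niece.probBound_zero_nonpos (by norm_num) hr)
        (Niece.probBound_zero_nonpos (by norm_num) hp))
    · refine (hmain P X Y Xs Ys hn hp hr hX hY hsub.fst hsub.snd hiid d u Δ ΔU ε
        hε hcov hpop hsmall).mono ?_
      rw [Niece.probBound, Niece.probBound, ← hep, ← her]
      have h1 : (p : ℝ) * ep ≤ p * r * ep := by gcongr; nlinarith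
      have h2 : (p : ℝ) * er ≤ p * r * er := by gcongr; nlinarith
      have h3 : (r : ℝ) * ep ≤ p * r * ep := by gcongr; nlinarith
      have h4 : 0 < (r : ℝ) ^ 2 * er := by positivity
      have h5 : 0 < (p : ℝ) ^ 2 * ep := by positivity
      have h6 : 0 < (p : ℝ) * r * er := by positivity
      -- A single event, whose probability dominates both bounds, serves for the maximum.
      refine max_le ?_ ?_ <;> linarith
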